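/- **Language.** Let $\mathcal L_{\mathbb N}$ be the language of arithmetic with $0,S,+,\times$, a pairing function, the numeral function $\mathrm{num}$ ($n\mapsto\#\overline n$), and function symbols $\underset{.}{=},\underset{.}{\neq},\underset{.}{T},\underset{.}{P},\underset{.}{\neg T},\underset{.}{\neg P},\underset{.}{\wedge},\underset{.}{\vee},\underset{.}{\forall},\underset{.}{\exists}$ for the corresponding syntactic operations on Gödel numbers $\#e$; let $\mathcal L=\mathcal L_{\mathbb N}\cup\{T,P\}$. Formulae are built from the literals $t=s$, $t\ne s$, $Tt$, $\neg Tt$, $Pt$, $\neg Pt$ by $\wedge,\vee,\forall,\exists$; $\neg$ is defined by De Morgan duality with $\neg\neg\varphi:=\varphi$, and $\ulcorner\varphi\urcorner$ is the numeral of $\#\varphi$. $\mathrm{PA[SK]}$ is the two-sided sequent calculus of Strong Kleene logic with identity (initial sequents $\varphi\Rightarrow\varphi$; cut; weakening; left and right rules for $\vee,\wedge,\exists,\forall$; from $\Gamma\Rightarrow\Delta,\varphi$ infer $\neg\varphi,\Gamma\Rightarrow\Delta$; $\Gamma\Rightarrow\Delta,t=t$; from $\Gamma\Rightarrow\Delta,\varphi(t)$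 infer $\Gamma\Rightarrow\Delta,s\neq t,\varphi(s)$) plus the initial sequents of Peano arithmetic, including defining equations of the extra function symbols, and the induction rule (from $\varphi(u),\Gamma\Rightarrow\Delta,\varphi(Su)$, $u$ an eigenvariable, infer $\varphi(0),\Gamma\Rightarrow\Delta,\varphi(t)$) for all $\mathcal L$-formulae. $\Phi\Leftrightarrow\Psi$ abbreviates the two sequents $\Phi\Rightarrow\Psi$ and $\Psi\Rightarrow\Phi$. Sentences $\varphi,\psi$ are $\mathrm{PA[SK]}$-equivalent if $\mathrm{PA[SK]}\vdash\varphi\Leftrightarrow\psi$ and $\mathrm{PA[SK]}\vdash\neg\varphi\Leftrightarrow\neg\psi$. A sentence $\varphi$ is *base paradoxical* if it is $\mathrm{PA[SK]}$-equivalent to $\neg T\ulcorner\varphi\urcorner$. Let $\mathrm{ClTm}(x)$, $\mathrm{Sent}(x)$, $\mathrm{val}(x)=y$, $\mathrm{neg}(x)=y$, $\mathrm{subst}(x,y,z)=w$, $B(x)$ be any $\mathcal L_{\mathbb N}$-formulae that define in $\mathbb N$, respectively, the closed terms, the sentences, the evaluation of closed terms, the negation of formulae, the substitution of closed terms for variables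 in formulae, and the base paradoxical sentences (all via codes). Put $\Pi(x):=B(x)\vee B(\mathrm{neg}(x))$, and let $u(z)$ denote the result of substituting $\mathrm{num}(z)$ for the variable (coded by) $v$ in the formula (coded by) $u$, where $v$ is the variable bound by the quantifier. **The theory** $\mathrm{TP}$ expands $\mathrm{PA[SK]}$ by the following initial sequents, where $s,t$ range over codes of closed terms, $\varphi,\psi$ over codes of formulae, and the formulae that are arguments of $\underset{.}{\wedge},\underset{.}{\vee},\underset{.}{\forall},\underset{.}{\exists},\mathrm{neg}$ are such that the displayed compounds are (codes of) sentences (these conditions being added to the left-hand sides). The dots are omitted in the display: e.g. $T(\varphi\wedge\psi)$ stands for $T(\varphi\mathbin{\underset{.}{\wedge}}\psi)$. - $(T_1)$ $\mathrm{val}(s)=\mathrm{val}(t)\Leftrightarrow T(s=t)$; $\mathrm{val}(s)\ne\mathrm{val}(t)\Leftrightarrow T(s\neq t)$ - $(T_2)$ $P(\mathrm{val}(s))\Leftrightarrow T(Ps)$; $\neg P(\mathrm{val}(s))\Leftrightarrow T(\neg Ps)$ - $(T_3)$ $T(\mathrm{val}(s))\Leftrightarrow T(Ts)$; $T(\neg\varphi)\Leftrightarrow\neg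 T\varphi$ - $(T_4)$ $T\varphi\wedge T\psi\Leftrightarrow T(\varphi\wedge\psi)$; $T\varphi\vee T\psi\Leftrightarrow T(\varphi\vee\psi)$ - $(T_5)$ $\forall x\,T\varphi(x)\Leftrightarrow T(\forall x\varphi)$; $\exists x\,T\varphi(x)\Leftrightarrow T(\exists x\varphi)$ - $(P_1)$ $\Pi(\varphi)\Rightarrow P\varphi$ for sentences $\varphi$ - $(P_2)$ $P(\neg As)\Leftrightarrow P(As)$ for $A\in\{T,P\}$ - $(P_3)$ $P(Ts)\Leftrightarrow P(\mathrm{val}(s))\vee\Pi(Ts)$ - $(P_4)$ $P(\varphi\wedge\psi)\Leftrightarrow(P\varphi\wedge P\psi)\vee(T\varphi\wedge P\psi)\vee(T\psi\wedge P\varphi)\vee\Pi(\varphi\wedge\psi)$ - $(P_5)$ $P(\varphi\vee\psi)\Leftrightarrow(P\varphi\wedge P\psi)\vee(\neg T\varphi\wedge P\psi)\vee(\neg T\psi\wedge P\varphi)\vee\Pi(\varphi\vee\psi)$ - $(P_6)$ $P(\forall x\varphi)\Leftrightarrow\big(\exists xP\varphi(x)\wedge\forall y(P\varphi(y)\vee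 T\varphi(y))\big)\vee\Pi(\forall x\varphi)$ - $(P_7)$ $P(\exists x\varphi)\Leftrightarrow\big(\exists xP\varphi(x)\wedge\forall y(P\varphi(y)\vee\neg T\varphi(y))\big)\vee\Pi(\exists x\varphi)$ - $(I_1)$ $T(\varphi\vee\neg\varphi)\Rightarrow\neg P\varphi$ for sentences $\varphi$. **Semantics.** For $T=(T^+,T^-)$ and $P=(P^+,P^-)$ in $\mathcal P(\omega)^2$, $(\mathbb N,T,P)\vDash\varphi$ is Strong Kleene satisfaction, with $T^+,P^+$ the extensions and $T^-,P^-$ the anti-extensions of the predicates. $(\mathbb N,T,P)\vDash\Gamma\Rightarrow\Delta$ means that, under every assignment, if all of $\Gamma$ is satisfied then some member of $\Delta$ is; $(\mathbb N,T,P)$ is a model of a system if it satisfies all its derivable sequents. Let $\mathscr P(x)$ be the disjunction of: (1) $\mathrm{Sent}(x)\wedge\Pi(x)$; (2) $\mathrm{Sent}(x)\wedge\exists s(x=\underset{.}{T}s\wedge P(\mathrm{val}(s)))$; (3) $\mathrm{Sent}(x)\wedge\exists s(x=\mathrm{neg}(\underset{.}{T}s)\wedge P(\mathrm{val}(s)))$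 ($s$ ranging over closed terms); (4)–(7): $\mathrm{Sent}(x)$ and $x$ is a conjunction, disjunction, universal or existential formula whose constituents satisfy the right-hand side of $(P_4)$, $(P_5)$, $(P_6)$, $(P_7)$ respectively, with the disjunct $\Pi$ omitted. Let $(T_\infty,P_\infty)$ be the least fixed point, for componentwise inclusion, of the monotone operator $\Gamma_{TP}$ that sends $(T,P)$ to $$\Big(\big(\{\#\varphi:\ \vDash\varphi\},\{\#\varphi:\ \vDash\neg\varphi\}\big),\ \big(\{\#\varphi:\ \vDash\mathscr P(\ulcorner\varphi\urcorner)\},\{\#\varphi:\ \vDash\varphi\vee\neg\varphi\}\big)\Big),$$ where $\varphi$ ranges over sentences and $\vDash$ is satisfaction in $(\mathbb N,T,P)$. **Theorem.** $(\mathbb N,T_\infty,P_\infty)$ is a model of $\mathrm{TP}$. Hence $\mathrm{TP}$ is $\omega$-consistent: there is no formula $\varphi(x)$ such that $\mathrm{TP}$ derives $\Rightarrow\exists x\varphi(x)$ and $\varphi(\overline n)\Rightarrow$ for every $n$ (in particular none for which it derives $\Rightarrow\exists x\varphi(x)$ and all $\Rightarrow\neg\varphi(\overline n)$), and none such that it derives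 $\forall x\varphi(x)\Rightarrow$ and $\Rightarrow\varphi(\overline n)$ for every $n$. -/

import Mathlib

namespace TruthPar

/-! ### Syntax -/

/-- Unary function symbols: successor, the numeral function, and the syntactic operations
`#t ↦ #(T t)`, `#t ↦ #(P t)`, `#t ↦ #(¬T t)`, `#t ↦ #(¬P t)`. -/
inductive Fn1 where
  | succ | num | dT | dP | dnT | dnP
  deriving DecidableEq

/-- Binary function symbols: addition, multiplication, a pairing function (used for the Gödel
numbering), and the syntactic operations building codes of `t = s`, `t ≠ s`, `φ ∧ ψ`, `φ ∨ ψ`,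
`∀ v φ`, `∃ v φ` from the codes of their constituents. -/
inductive Fn2 where
  | add | mul | pair | dEq | dNe | dAnd | dOr | dAll | dEx
  deriving DecidableEq

inductive Term where
  | var (k : ℕ)
  | zero
  | app1 (f : Fn1) (t : Term)
  | app2 (f : Fn2) (t s : Term)
  deriving DecidableEq

/-- Formulae in Tait style: built from the literals `t = s`, `t ≠ s`, `T t`, `¬T t`, `P t`, `¬P t`
by `∧`, `∨`, `∀`, `∃`. -/
inductive Fml where
  | eq (t s : Term)
  | ne (t s : Term)
  | T (t : Term)
  | nT (t : Term)
  | P (t : Term)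
  | nP (t : Term)
  | and (φ ψ : Fml)
  | or (φ ψ : Fml)
  | all (k : ℕ) (φ : Fml)
  | ex (k : ℕ) (φ : Fml)
  deriving DecidableEq

namespace Term

/-- Variables occurring in a term. -/
def fv : Term → Finset ℕ
  | var k => {k}
  | zero => ∅
  | app1 _ t => t.fv
  | app2 _ t s => t.fv ∪ s.fv

/-- `t.subst x r` is `t[r/x]`. -/
def subst : Term → ℕ → Term → Term
  | var k, x, r => if k = x then r else var k
  | zero, _, _ => zero
  | app1 f t, x, r => app1 f (t.subst x r)
  | app2 f t s, x, r => app2 f (t.subst x r) (s.subst x r)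

/-- A strict upper bound for the indices of the variables of a term. -/
def bound : Term → ℕ
  | var k => k + 1
  | zero => 0
  | app1 _ t => t.bound
  | app2 _ t s => max t.bound s.bound

/-- The numeral of `n`. -/
def numeral : ℕ → Term
  | 0 => zero
  | n + 1 => app1 .succ (numeral n)

end Term

namespace Fml

/-- Free variables. -/
def fv : Fml → Finset ℕ
  | eq t s => t.fv ∪ s.fv
  | ne t s => t.fv ∪ s.fv
  | T t => t.fv
  | nT t => t.fv
  | P t => t.fv
  | nP t => t.fv
  | and φ ψ => φ.fv ∪ ψ.fv
  | or φ ψ => φ.fv ∪ ψ.fv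
  | all k φ => φ.fv.erase k
  | ex k φ => φ.fv.erase k

def IsSentence (φ : Fml) : Prop := φ.fv = ∅

/-- Formulae of the language of arithmetic, i.e. without `T` and `P`. -/
def IsArith : Fml → Prop
  | eq _ _ => True
  | ne _ _ => True
  | T _ => False
  | nT _ => False
  | P _ => False
  | nP _ => False
  | and φ ψ => φ.IsArith ∧ ψ.IsArith
  | or φ ψ => φ.IsArith ∧ ψ.IsArith
  | all _ φ => φ.IsArith
  | ex _ φ => φ.IsArith

/-- Negation, defined by De Morgan dualities; `¬¬φ` is `φ`. -/
def neg : Fml → Fml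
  | eq t s => ne t s
  | ne t s => eq t s
  | T t => nT t
  | nT t => T t
  | P t => nP t
  | nP t => P t
  | and φ ψ => or φ.neg ψ.neg
  | or φ ψ => and φ.neg ψ.neg
  | all k φ => ex k φ.neg
  | ex k φ => all k φ.neg

/-- `φ.subst x r` replaces the free occurrences of the variable `x` by `r`; it is the correct
substitution whenever `r` is free for `x` in `φ`, see `FreeFor`. -/
def subst (x : ℕ) (r : Term) : Fml → Fml
  | eq t s => eq (t.subst x r) (s.subst x r)
  | ne t s => ne (t.subst x r) (s.subst x r)
  | T t => T (t.subst x r)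
  | nT t => nT (t.subst x r)
  | P t => P (t.subst x r)
  | nP t => nP (t.subst x r)
  | and φ ψ => and (φ.subst x r) (ψ.subst x r)
  | or φ ψ => or (φ.subst x r) (ψ.subst x r)
  | all k φ => if k = x then all k φ else all k (φ.subst x r)
  | ex k φ => if k = x then ex k φ else ex k (φ.subst x r)

/-- The term `r` is free for `x` in the formula: no variable of `r` gets captured. -/
def FreeFor (r : Term) (x : ℕ) : Fml → Prop
  | eq _ _ => True
  | ne _ _ => True
  | T _ => True
  | nT _ => True
  | P _ => True
  | nP _ => True
  | and φ ψ => φ.FreeFor r x ∧ ψ.FreeFor r x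
  | or φ ψ => φ.FreeFor r x ∧ ψ.FreeFor r x
  | all k φ => x ∉ (all k φ).fv ∨ (k ∉ r.fv ∧ φ.FreeFor r x)
  | ex k φ => x ∉ (ex k φ).fv ∨ (k ∉ r.fv ∧ φ.FreeFor r x)

/-- A strict upper bound for the indices of all variables, free or bound, of a formula. -/
def bound : Fml → ℕ
  | eq t s => max t.bound s.bound
  | ne t s => max t.bound s.bound
  | T t => t.bound
  | nT t => t.bound
  | P t => t.bound
  | nP t => t.bound
  | and φ ψ => max φ.bound ψ.bound
  | or φ ψ => max φ.bound ψ.bound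
  | all k φ => max (k + 1) φ.bound
  | ex k φ => max (k + 1) φ.bound

end Fml

/-! ### Gödel numbering -/

def Fn1.index : Fn1 → ℕ
  | .succ => 0
  | .num => 1
  | .dT => 2
  | .dP => 3
  | .dnT => 4
  | .dnP => 5

def Fn2.index : Fn2 → ℕ
  | .add => 0
  | .mul => 1
  | .pair => 2
  | .dEq => 3
  | .dNe => 4
  | .dAnd => 5
  | .dOr => 6
  | .dAll => 7
  | .dEx => 8

/-- The Gödel number of a term. -/
def Term.code : Term → ℕ
  | .var k => Nat.pair 0 k
  | .zero => Nat.pair 1 0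
  | .app1 f t => Nat.pair 2 (Nat.pair f.index t.code)
  | .app2 f t s => Nat.pair 3 (Nat.pair f.index (Nat.pair t.code s.code))

/-- The Gödel number of a formula. -/
def Fml.code : Fml → ℕ
  | .eq t s => Nat.pair 4 (Nat.pair t.code s.code)
  | .ne t s => Nat.pair 5 (Nat.pair t.code s.code)
  | .T t => Nat.pair 6 t.code
  | .nT t => Nat.pair 7 t.code
  | .P t => Nat.pair 8 t.code
  | .nP t => Nat.pair 9 t.code
  | .and φ ψ => Nat.pair 10 (Nat.pair φ.code ψ.code)
  | .or φ ψ => Nat.pair 11 (Nat.pair φ.code ψ.code)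
  | .all k φ => Nat.pair 12 (Nat.pair (Term.var k).code φ.code)
  | .ex k φ => Nat.pair 13 (Nat.pair (Term.var k).code φ.code)

/-- The closed term `⌜φ⌝` naming the Gödel number of `φ`. -/
def Fml.quote (φ : Fml) : Term := Term.numeral φ.code

/-! ### Strong Kleene semantics over the standard model -/

def Fn1.eval : Fn1 → ℕ → ℕ
  | .succ, n => n + 1
  | .num, n => (Term.numeral n).code
  | .dT, n => Nat.pair 6 n
  | .dnT, n => Nat.pair 7 n
  | .dP, n => Nat.pair 8 n
  | .dnP, n => Nat.pair 9 n

def Fn2.eval : Fn2 → ℕ → ℕ → ℕ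
  | .add, m, n => m + n
  | .mul, m, n => m * n
  | .pair, m, n => Nat.pair m n
  | .dEq, m, n => Nat.pair 4 (Nat.pair m n)
  | .dNe, m, n => Nat.pair 5 (Nat.pair m n)
  | .dAnd, m, n => Nat.pair 10 (Nat.pair m n)
  | .dOr, m, n => Nat.pair 11 (Nat.pair m n)
  | .dAll, m, n => Nat.pair 12 (Nat.pair m n)
  | .dEx, m, n => Nat.pair 13 (Nat.pair m n)

/-- The value of a term in the standard model under an assignment. -/
def Term.eval (e : ℕ → ℕ) : Term → ℕ
  | .var k => e k
  | .zero => 0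
  | .app1 f t => f.eval (t.eval e)
  | .app2 f t s => f.eval (t.eval e) (s.eval e)

/-- An interpretation `(T, P) = ((T⁺, T⁻), (P⁺, P⁻))` of the two predicates over the standard model,
ordered componentwise by inclusion. -/
abbrev Interp : Type := (Set ℕ × Set ℕ) × (Set ℕ × Set ℕ)

/-- Strong Kleene satisfaction `(ℕ, T, P) ⊨ φ [e]`. -/
def Sat (I : Interp) : (ℕ → ℕ) → Fml → Prop
  | e, .eq t s => t.eval e = s.eval e
  | e, .ne t s => t.eval e ≠ s.eval e
  | e, .T t => t.eval e ∈ I.1.1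
  | e, .nT t => t.eval e ∈ I.1.2
  | e, .P t => t.eval e ∈ I.2.1
  | e, .nP t => t.eval e ∈ I.2.2
  | e, .and φ ψ => Sat I e φ ∧ Sat I e ψ
  | e, .or φ ψ => Sat I e φ ∨ Sat I e ψ
  | e, .all k φ => ∀ n : ℕ, Sat I (Function.update e k n) φ
  | e, .ex k φ => ∃ n : ℕ, Sat I (Function.update e k n) φ

/-- `(ℕ, T, P) ⊨ φ`; for a sentence the assignment is irrelevant. -/
def Holds (I : Interp) (φ : Fml) : Prop := ∀ e : ℕ → ℕ, Sat I e φ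

theorem Sat.mono {I J : Interp} (h : I ≤ J) (φ : Fml) :
    ∀ e : ℕ → ℕ, Sat I e φ → Sat J e φ := by
  induction φ with
  | eq t s => exact fun _ hs => hs
  | ne t s => exact fun _ hs => hs
  | T t => exact fun _ hs => h.1.1 hs
  | nT t => exact fun _ hs => h.1.2 hs
  | P t => exact fun _ hs => h.2.1 hs
  | nP t => exact fun _ hs => h.2.2 hs
  | and φ ψ h1 h2 => exact fun e hs => ⟨h1 e hs.1, h2 e hs.2⟩
  | or φ ψ h1 h2 => exact fun e hs => Or.imp (h1 e) (h2 e) hs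
  | all k φ ih => exact fun e hs n => ih _ (hs n)
  | ex k φ ih => exact fun e hs => Exists.imp (fun n hn => ih _ hn) hs

theorem Holds.mono {I J : Interp} (h : I ≤ J) {φ : Fml} (hI : Holds I φ) : Holds J φ :=
  fun e => Sat.mono h φ e (hI e)

/-! ### Sequents and the calculus -/

/-- A sequent `Γ ⇒ Δ`, as the pair `(Γ, Δ)` of finite sets of formulae. -/
abbrev Sequent : Type := Finset Fml × Finset Fml

/-- `(ℕ, T, P) ⊨ Γ ⇒ Δ`; free variables are read universally. -/
def SeqHolds (I : Interp) (S : Sequent) : Prop :=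
  ∀ e : ℕ → ℕ, (∀ γ ∈ S.1, Sat I e γ) → ∃ δ ∈ S.2, Sat I e δ

/-- The eigenvariable condition: no formula of the sequent contains `u` free. -/
def Sequent.Fresh (u : ℕ) (Γ Δ : Finset Fml) : Prop := ∀ χ ∈ Γ ∪ Δ, u ∉ χ.fv

/-- Sequents derivable by the rules of Strong Kleene logic with identity and the induction rule for
all formulae, from the additional initial sequents `Ax`. -/
inductive Deriv (Ax : Set Sequent) : Finset Fml → Finset Fml → Prop
  | ax {Γ Δ : Finset Fml} : (Γ, Δ) ∈ Ax → Deriv Ax Γ Δ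
  | init (φ : Fml) : Deriv Ax {φ} {φ}
  | negL {Γ Δ : Finset Fml} {φ : Fml} :
      Deriv Ax Γ (insert φ Δ) → Deriv Ax (insert φ.neg Γ) Δ
  | cut {Γ Δ : Finset Fml} {φ : Fml} :
      Deriv Ax Γ (insert φ Δ) → Deriv Ax (insert φ Γ) Δ → Deriv Ax Γ Δ
  | weakL {Γ Δ : Finset Fml} (φ : Fml) : Deriv Ax Γ Δ → Deriv Ax (insert φ Γ) Δ
  | weakR {Γ Δ : Finset Fml} (φ : Fml) : Deriv Ax Γ Δ → Deriv Ax Γ (insert φ Δ)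
  | orL {Γ Δ : Finset Fml} {φ ψ : Fml} :
      Deriv Ax (insert φ Γ) Δ → Deriv Ax (insert ψ Γ) Δ → Deriv Ax (insert (φ.or ψ) Γ) Δ
  | orR {Γ Δ : Finset Fml} {φ ψ : Fml} :
      Deriv Ax Γ (insert φ (insert ψ Δ)) → Deriv Ax Γ (insert (φ.or ψ) Δ)
  | andL {Γ Δ : Finset Fml} {φ ψ : Fml} :
      Deriv Ax (insert φ (insert ψ Γ)) Δ → Deriv Ax (insert (φ.and ψ) Γ) Δ
  | andR {Γ Δ : Finset Fml} {φ ψ : Fml} :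
      Deriv Ax Γ (insert φ Δ) → Deriv Ax Γ (insert ψ Δ) → Deriv Ax Γ (insert (φ.and ψ) Δ)
  | exL {Γ Δ : Finset Fml} {φ : Fml} {x u : ℕ} :
      φ.FreeFor (.var u) x → u ∉ (Fml.ex x φ).fv → Sequent.Fresh u Γ Δ →
      Deriv Ax (insert (φ.subst x (.var u)) Γ) Δ → Deriv Ax (insert (Fml.ex x φ) Γ) Δ
  | exR {Γ Δ : Finset Fml} {φ : Fml} {x : ℕ} {t : Term} :
      φ.FreeFor t x →
      Deriv Ax Γ (insert (φ.subst x t) Δ) → Deriv Ax Γ (insert (Fml.ex x φ) Δ)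
  | allL {Γ Δ : Finset Fml} {φ : Fml} {x : ℕ} {t : Term} :
      φ.FreeFor t x →
      Deriv Ax (insert (φ.subst x t) Γ) Δ → Deriv Ax (insert (Fml.all x φ) Γ) Δ
  | allR {Γ Δ : Finset Fml} {φ : Fml} {x u : ℕ} :
      φ.FreeFor (.var u) x → u ∉ (Fml.all x φ).fv → Sequent.Fresh u Γ Δ →
      Deriv Ax Γ (insert (φ.subst x (.var u)) Δ) → Deriv Ax Γ (insert (Fml.all x φ) Δ)
  | ref {Γ Δ : Finset Fml} (t : Term) : Deriv Ax Γ (insert (Fml.eq t t) Δ)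
  | repl {Γ Δ : Finset Fml} {φ : Fml} {x : ℕ} {s t : Term} :
      φ.FreeFor s x → φ.FreeFor t x →
      Deriv Ax Γ (insert (φ.subst x t) Δ) →
      Deriv Ax Γ (insert (Fml.ne s t) (insert (φ.subst x s) Δ))
  | ind {Γ Δ : Finset Fml} {φ : Fml} {u : ℕ} {t : Term} :
      φ.FreeFor t u → Sequent.Fresh u Γ Δ →
      Deriv Ax (insert φ Γ) (insert (φ.subst u (.app1 .succ (.var u))) Δ) →
      Deriv Ax (insert (φ.subst u .zero) Γ) (insert (φ.subst u t) Δ)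

/-- The initial sequents of Peano arithmetic: the usual ones for `0`, `S`, `+`, `×`, and the defining
equations of the additional function symbols. -/
inductive PAInit : Sequent → Prop
  | succ_ne (t : Term) : PAInit ({.eq (.app1 .succ t) .zero}, ∅)
  | succ_inj (t s : Term) : PAInit ({.eq (.app1 .succ t) (.app1 .succ s)}, {.eq t s})
  | add_zero (t : Term) : PAInit (∅, {.eq (.app2 .add t .zero) t})
  | add_succ (t s : Term) :
      PAInit (∅, {.eq (.app2 .add t (.app1 .succ s)) (.app1 .succ (.app2 .add t s))})
  | mul_zero (t : Term) : PAInit (∅, {.eq (.app2 .mul t .zero) .zero})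
  | mul_succ (t s : Term) :
      PAInit (∅, {.eq (.app2 .mul t (.app1 .succ s)) (.app2 .add (.app2 .mul t s) t)})
  /- For `b = a + S c` the pair of `a` and `b` is `b * b + a`. -/
  | pair_lt (a c b : Term) : b = .app2 .add a (.app1 .succ c) →
      PAInit (∅, {.eq (.app2 .pair a b) (.app2 .add (.app2 .mul b b) a)})
  /- For `a = b + c` the pair of `a` and `b` is `(a * a + a) + b`. -/
  | pair_ge (b c a : Term) : a = .app2 .add b c →
      PAInit (∅, {.eq (.app2 .pair a b) (.app2 .add (.app2 .add (.app2 .mul a a) a) b)})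
  | num_zero : PAInit (∅, {.eq (.app1 .num .zero) (.numeral Term.zero.code)})
  | num_succ (t : Term) :
      PAInit (∅, {.eq (.app1 .num (.app1 .succ t))
        (.app2 .pair (.numeral 2) (.app2 .pair (.numeral Fn1.succ.index) (.app1 .num t)))})
  | dT (t : Term) : PAInit (∅, {.eq (.app1 .dT t) (.app2 .pair (.numeral 6) t)})
  | dnT (t : Term) : PAInit (∅, {.eq (.app1 .dnT t) (.app2 .pair (.numeral 7) t)})
  | dP (t : Term) : PAInit (∅, {.eq (.app1 .dP t) (.app2 .pair (.numeral 8) t)})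
  | dnP (t : Term) : PAInit (∅, {.eq (.app1 .dnP t) (.app2 .pair (.numeral 9) t)})
  | dEq (t s : Term) :
      PAInit (∅, {.eq (.app2 .dEq t s) (.app2 .pair (.numeral 4) (.app2 .pair t s))})
  | dNe (t s : Term) :
      PAInit (∅, {.eq (.app2 .dNe t s) (.app2 .pair (.numeral 5) (.app2 .pair t s))})
  | dAnd (t s : Term) :
      PAInit (∅, {.eq (.app2 .dAnd t s) (.app2 .pair (.numeral 10) (.app2 .pair t s))})
  | dOr (t s : Term) :
      PAInit (∅, {.eq (.app2 .dOr t s) (.app2 .pair (.numeral 11) (.app2 .pair t s))})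
  | dAll (t s : Term) :
      PAInit (∅, {.eq (.app2 .dAll t s) (.app2 .pair (.numeral 12) (.app2 .pair t s))})
  | dEx (t s : Term) :
      PAInit (∅, {.eq (.app2 .dEx t s) (.app2 .pair (.numeral 13) (.app2 .pair t s))})

/-- Derivability in `PA[SK]`. -/
def PASK : Finset Fml → Finset Fml → Prop := Deriv {S | PAInit S}

/-- `PA[SK]`-equivalence of two formulae: `φ ⇔ ψ` and `¬φ ⇔ ¬ψ` are derivable. -/
def PASKEquiv (φ ψ : Fml) : Prop :=
  (PASK {φ} {ψ} ∧ PASK {ψ} {φ}) ∧ (PASK {φ.neg} {ψ.neg} ∧ PASK {ψ.neg} {φ.neg})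

/-- `φ` is a base paradoxical sentence: it is `PA[SK]`-equivalent to `¬T⌜φ⌝`. -/
def BaseParadoxical (φ : Fml) : Prop := φ.IsSentence ∧ PASKEquiv φ (.nT φ.quote)

/-! ### Arithmetical formulae representing syntactic notions -/

/-- A choice of formulae: `clTm(v₀)` (closed terms), `sent(v₀)` (sentences), `val(v₀, v₁)` (graph of the
evaluation of closed terms), `neg(v₀, v₁)` (graph of negation), `sub(v₀, v₁, v₂, v₃)` (graph of the
substitution of a closed term `v₁` for a variable `v₂` in a formula `v₀`) and `B(v₀)` (base paradoxical
sentences). -/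
structure Syn where
  clTm : Fml
  sent : Fml
  val : Fml
  neg : Fml
  sub : Fml
  B : Fml

/-- `φ` is an arithmetical formula whose free variables are among `v₀, …, v₍ₙ₋₁₎`. -/
def Fml.ArithIn (φ : Fml) (n : ℕ) : Prop := φ.IsArith ∧ ∀ k ∈ φ.fv, k < n

/-- The chosen formulae are arithmetical and define, in the standard model, the intended sets and
functions. The values of functions are prescribed only for arguments of the intended kind. -/
structure Syn.Represents (F : Syn) : Prop where
  clTm_arith : F.clTm.ArithIn 1
  sent_arith : F.sent.ArithIn 1
  val_arith : F.val.ArithIn 2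
  neg_arith : F.neg.ArithIn 2
  sub_arith : F.sub.ArithIn 4
  B_arith : F.B.ArithIn 1
  clTm_iff : ∀ (I : Interp) (e : ℕ → ℕ),
    Sat I e F.clTm ↔ ∃ t : Term, t.fv = ∅ ∧ t.code = e 0
  sent_iff : ∀ (I : Interp) (e : ℕ → ℕ),
    Sat I e F.sent ↔ ∃ φ : Fml, φ.IsSentence ∧ φ.code = e 0
  val_iff : ∀ (I : Interp) (e : ℕ → ℕ) (t : Term), t.fv = ∅ → e 0 = t.code →
    (Sat I e F.val ↔ e 1 = t.eval e)
  neg_iff : ∀ (I : Interp) (e : ℕ → ℕ) (φ : Fml), e 0 = φ.code →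
    (Sat I e F.neg ↔ e 1 = φ.neg.code)
  sub_iff : ∀ (I : Interp) (e : ℕ → ℕ) (φ : Fml) (t : Term) (k : ℕ), t.fv = ∅ →
    e 0 = φ.code → e 1 = t.code → e 2 = (Term.var k).code →
    (Sat I e F.sub ↔ e 3 = (φ.subst k t).code)
  B_iff : ∀ (I : Interp) (e : ℕ → ℕ),
    Sat I e F.B ↔ ∃ φ : Fml, BaseParadoxical φ ∧ φ.code = e 0

namespace Syn

variable (F : Syn)

/-- All variables of the chosen formulae, and `v₀, …, v₃`, have index below `F.off`. -/
def off : ℕ :=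
  max 4 (max F.clTm.bound (max F.sent.bound (max F.val.bound
    (max F.neg.bound (max F.sub.bound F.B.bound)))))

/-- Index of the `i`-th variable that does not occur in the chosen formulae. -/
def ix (i : ℕ) : ℕ := F.off + i

/-- The `i`-th variable that does not occur in the chosen formulae. Below, indices `0, …, 6` are used
for displayed variables and `10, …, 13` for the auxiliary quantifiers of the functional notation. -/
def v (i : ℕ) : Term := .var (F.ix i)

/-- `ClTm(t)` -/
def clTmF (t : Term) : Fml := F.clTm.subst 0 t

/-- `Sent(t)` -/
def sentF (t : Term) : Fml := F.sent.subst 0 t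

/-- `val(t) = s` -/
def valF (t s : Term) : Fml := (F.val.subst 0 t).subst 1 s

/-- `neg(t) = s` -/
def negF (t s : Term) : Fml := (F.neg.subst 0 t).subst 1 s

/-- `subst(x, t, z) = w` -/
def subF (x t z w : Term) : Fml := (((F.sub.subst 0 x).subst 1 t).subst 2 z).subst 3 w

/-- `B(t)` -/
def BF (t : Term) : Fml := F.B.subst 0 t

/-- `A(val(s))`, i.e. `∃ y (val(s) = y ∧ A(y))` -/
def atVal (A : Term → Fml) (s : Term) : Fml :=
  .ex (F.ix 10) (.and (F.valF s (F.v 10)) (A (F.v 10)))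

/-- `R(val(s), val(t))` -/
def atVal2 (R : Term → Term → Fml) (s t : Term) : Fml :=
  .ex (F.ix 10) (.ex (F.ix 11)
    (.and (.and (F.valF s (F.v 10)) (F.valF t (F.v 11))) (R (F.v 10) (F.v 11))))

/-- `A(neg(x))` -/
def atNeg (A : Term → Fml) (x : Term) : Fml :=
  .ex (F.ix 12) (.and (F.negF x (F.v 12)) (A (F.v 12)))

/-- `A(x(y))`, with `x(y)` the result of substituting the numeral of `y` for the variable coded by `z`
in the formula coded by `x`. -/
def atInst (A : Term → Fml) (x y z : Term) : Fml :=
  .ex (F.ix 13) (.and (F.subF x (.app1 .num y) z (F.v 13)) (A (F.v 13)))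

/-- `Π(x) := B(x) ∨ B(neg(x))` -/
def Pi (x : Term) : Fml := .or (F.BF x) (F.atNeg F.BF x)

/-- `(P y ∧ P z) ∨ (T y ∧ P z) ∨ (T z ∧ P y)` -/
def andClause (y z : Term) : Fml :=
  .or (.and (.P y) (.P z)) (.or (.and (.T y) (.P z)) (.and (.T z) (.P y)))

/-- `(P y ∧ P z) ∨ (¬T y ∧ P z) ∨ (¬T z ∧ P y)` -/
def orClause (y z : Term) : Fml :=
  .or (.and (.P y) (.P z)) (.or (.and (.nT y) (.P z)) (.and (.nT z) (.P y)))

/-- `∃ y P s(y) ∧ ∀ y (P s(y) ∨ T s(y))`, instances being taken for the variable coded by `z` -/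
def allClause (s z : Term) : Fml :=
  .and (.ex (F.ix 6) (F.atInst .P s (F.v 6) z))
    (.all (F.ix 6) (.or (F.atInst .P s (F.v 6) z) (F.atInst .T s (F.v 6) z)))

/-- `∃ y P s(y) ∧ ∀ y (P s(y) ∨ ¬T s(y))`, instances being taken for the variable coded by `z` -/
def exClause (s z : Term) : Fml :=
  .and (.ex (F.ix 6) (F.atInst .P s (F.v 6) z))
    (.all (F.ix 6) (.or (F.atInst .P s (F.v 6) z) (F.atInst .nT s (F.v 6) z)))

/-! ### The theory TP -/

/-- The two sequents `G, a ⇒ b` and `G, b ⇒ a`. -/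
def bi (G : Finset Fml) (a b : Fml) : Set Sequent := {(insert a G, {b}), (insert b G, {a})}

/-- `val s = val t ⇔ T(s =̣ t)` and `val s ≠ val t ⇔ T(s ≠̣ t)` for closed terms `s`, `t` -/
def T1 : Set Sequent :=
  bi {F.clTmF (F.v 0), F.clTmF (F.v 1)}
    (F.atVal2 .eq (F.v 0) (F.v 1)) (.T (.app2 .dEq (F.v 0) (F.v 1))) ∪
  bi {F.clTmF (F.v 0), F.clTmF (F.v 1)}
    (F.atVal2 .ne (F.v 0) (F.v 1)) (.T (.app2 .dNe (F.v 0) (F.v 1)))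

/-- `P(val s) ⇔ T(Ṗ s)` and `¬P(val s) ⇔ T(¬Ṗ s)` for closed terms `s` -/
def T2 : Set Sequent :=
  bi {F.clTmF (F.v 0)} (F.atVal .P (F.v 0)) (.T (.app1 .dP (F.v 0))) ∪
  bi {F.clTmF (F.v 0)} (F.atVal .nP (F.v 0)) (.T (.app1 .dnP (F.v 0)))

/-- `T(val s) ⇔ T(Ṫ s)` for closed terms `s`, and `T(neg φ) ⇔ ¬T φ` for sentences `φ` -/
def T3 : Set Sequent :=
  bi {F.clTmF (F.v 0)} (F.atVal .T (F.v 0)) (.T (.app1 .dT (F.v 0))) ∪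
  bi {F.sentF (F.v 0)} (F.atNeg .T (F.v 0)) (.nT (F.v 0))

/-- `T φ ∧ T ψ ⇔ T(φ ∧̣ ψ)` and `T φ ∨ T ψ ⇔ T(φ ∨̣ ψ)` -/
def T4 : Set Sequent :=
  bi {F.sentF (.app2 .dAnd (F.v 0) (F.v 1))}
    (.and (.T (F.v 0)) (.T (F.v 1))) (.T (.app2 .dAnd (F.v 0) (F.v 1))) ∪
  bi {F.sentF (.app2 .dOr (F.v 0) (F.v 1))}
    (.or (.T (F.v 0)) (.T (F.v 1))) (.T (.app2 .dOr (F.v 0) (F.v 1)))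

/-- `∀ x T φ(x) ⇔ T(∀̣ x φ)` and `∃ x T φ(x) ⇔ T(∃̣ x φ)`; here `v 0` codes the variable and `v 1` the
formula. -/
def T5 : Set Sequent :=
  bi {F.sentF (.app2 .dAll (F.v 0) (F.v 1))}
    (.all (F.ix 6) (F.atInst .T (F.v 1) (F.v 6) (F.v 0))) (.T (.app2 .dAll (F.v 0) (F.v 1))) ∪
  bi {F.sentF (.app2 .dEx (F.v 0) (F.v 1))}
    (.ex (F.ix 6) (F.atInst .T (F.v 1) (F.v 6) (F.v 0))) (.T (.app2 .dEx (F.v 0) (F.v 1)))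

/-- `Π(φ) ⇒ P φ` -/
def P1 : Set Sequent := {({F.sentF (F.v 0), F.Pi (F.v 0)}, {.P (F.v 0)})}

/-- `P(¬Ȧ s) ⇔ P(Ȧ s)` for `A` one of `T`, `P` -/
def P2 : Set Sequent :=
  bi {F.clTmF (F.v 0)} (.P (.app1 .dnT (F.v 0))) (.P (.app1 .dT (F.v 0))) ∪
  bi {F.clTmF (F.v 0)} (.P (.app1 .dnP (F.v 0))) (.P (.app1 .dP (F.v 0)))

/-- `P(Ṫ s) ⇔ P(val s) ∨ Π(Ṫ s)` -/
def P3 : Set Sequent :=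
  bi {F.clTmF (F.v 0)} (.P (.app1 .dT (F.v 0)))
    (.or (F.atVal .P (F.v 0)) (F.Pi (.app1 .dT (F.v 0))))

/-- `P(φ ∧̣ ψ) ⇔ (P φ ∧ P ψ) ∨ (T φ ∧ P ψ) ∨ (T ψ ∧ P φ) ∨ Π(φ ∧̣ ψ)` -/
def P4 : Set Sequent :=
  bi {F.sentF (.app2 .dAnd (F.v 0) (F.v 1))} (.P (.app2 .dAnd (F.v 0) (F.v 1)))
    (.or (andClause (F.v 0) (F.v 1)) (F.Pi (.app2 .dAnd (F.v 0) (F.v 1))))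

/-- `P(φ ∨̣ ψ) ⇔ (P φ ∧ P ψ) ∨ (¬T φ ∧ P ψ) ∨ (¬T ψ ∧ P φ) ∨ Π(φ ∨̣ ψ)` -/
def P5 : Set Sequent :=
  bi {F.sentF (.app2 .dOr (F.v 0) (F.v 1))} (.P (.app2 .dOr (F.v 0) (F.v 1)))
    (.or (orClause (F.v 0) (F.v 1)) (F.Pi (.app2 .dOr (F.v 0) (F.v 1))))

/-- `P(∀̣ x φ) ⇔ (∃ x P φ(x) ∧ ∀ y (P φ(y) ∨ T φ(y))) ∨ Π(∀̣ x φ)` -/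
def P6 : Set Sequent :=
  bi {F.sentF (.app2 .dAll (F.v 0) (F.v 1))} (.P (.app2 .dAll (F.v 0) (F.v 1)))
    (.or (F.allClause (F.v 1) (F.v 0)) (F.Pi (.app2 .dAll (F.v 0) (F.v 1))))

/-- `P(∃̣ x φ) ⇔ (∃ x P φ(x) ∧ ∀ y (P φ(y) ∨ ¬T φ(y))) ∨ Π(∃̣ x φ)` -/
def P7 : Set Sequent :=
  bi {F.sentF (.app2 .dEx (F.v 0) (F.v 1))} (.P (.app2 .dEx (F.v 0) (F.v 1)))
    (.or (F.exClause (F.v 1) (F.v 0)) (F.Pi (.app2 .dEx (F.v 0) (F.v 1))))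

/-- `T(φ ∨̣ neg φ) ⇒ ¬P φ` -/
def I1 : Set Sequent :=
  {({F.sentF (F.v 0), F.atNeg (fun y => .T (.app2 .dOr (F.v 0) y)) (F.v 0)}, {.nP (F.v 0)})}

/-- The truth, paradoxicality and interaction principles. -/
def principles : Set Sequent :=
  F.T1 ∪ F.T2 ∪ F.T3 ∪ F.T4 ∪ F.T5 ∪
  F.P1 ∪ F.P2 ∪ F.P3 ∪ F.P4 ∪ F.P5 ∪ F.P6 ∪ F.P7 ∪ F.I1

/-- Derivability in the theory `TP`: `PA[SK]` expanded with the principles. -/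
def TP : Finset Fml → Finset Fml → Prop := Deriv ({S | PAInit S} ∪ F.principles)

/-! ### The jump operator and its least fixed point -/

/-- `Sent(x) ∧ Π(x)` -/
def par1 (x : Term) : Fml := .and (F.sentF x) (F.Pi x)

/-- `Sent(x) ∧ ∃ s (x = Ṫ s ∧ P(val s))`, `s` ranging over closed terms -/
def par2 (x : Term) : Fml :=
  .and (F.sentF x) (.ex (F.ix 3) (.and (F.clTmF (F.v 3))
    (.and (.eq x (.app1 .dT (F.v 3))) (F.atVal .P (F.v 3)))))

/-- `Sent(x) ∧ ∃ s (x = neg(Ṫ s) ∧ P(val s))`, `s` ranging over closed terms -/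
def par3 (x : Term) : Fml :=
  .and (F.sentF x) (.ex (F.ix 3) (.and (F.clTmF (F.v 3))
    (.and (F.atNeg (fun y => .eq x y) (.app1 .dT (F.v 3))) (F.atVal .P (F.v 3)))))

/-- `Sent(x) ∧ ∃ y ∃ z (x = y ∧̣ z ∧ [(P y ∧ P z) ∨ (T y ∧ P z) ∨ (T z ∧ P y)])` -/
def par4 (x : Term) : Fml :=
  .and (F.sentF x) (.ex (F.ix 1) (.ex (F.ix 2)
    (.and (.eq x (.app2 .dAnd (F.v 1) (F.v 2))) (andClause (F.v 1) (F.v 2)))))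

/-- `Sent(x) ∧ ∃ y ∃ z (x = y ∨̣ z ∧ [(P y ∧ P z) ∨ (¬T y ∧ P z) ∨ (¬T z ∧ P y)])` -/
def par5 (x : Term) : Fml :=
  .and (F.sentF x) (.ex (F.ix 1) (.ex (F.ix 2)
    (.and (.eq x (.app2 .dOr (F.v 1) (F.v 2))) (orClause (F.v 1) (F.v 2)))))

/-- `Sent(x) ∧ ∃ v ∃ s (x = ∀̣ v s ∧ ∃ y P s(y) ∧ ∀ y (P s(y) ∨ T s(y)))` -/
def par6 (x : Term) : Fml :=
  .and (F.sentF x) (.ex (F.ix 1) (.ex (F.ix 2)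
    (.and (.eq x (.app2 .dAll (F.v 1) (F.v 2))) (F.allClause (F.v 2) (F.v 1)))))

/-- `Sent(x) ∧ ∃ v ∃ s (x = ∃̣ v s ∧ ∃ y P s(y) ∧ ∀ y (P s(y) ∨ ¬T s(y)))` -/
def par7 (x : Term) : Fml :=
  .and (F.sentF x) (.ex (F.ix 1) (.ex (F.ix 2)
    (.and (.eq x (.app2 .dEx (F.v 1) (F.v 2))) (F.exClause (F.v 2) (F.v 1)))))

/-- The formula `𝒫(x)` collecting the closure conditions of paradoxicality. -/
def par (x : Term) : Fml :=
  .or (F.par1 x) (.or (F.par2 x) (.or (F.par3 x) (.or (F.par4 x)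
    (.or (F.par5 x) (.or (F.par6 x) (F.par7 x))))))

/-- The set of codes of sentences with a given property. -/
def codes (p : Fml → Prop) : Set ℕ := {n | ∃ φ : Fml, φ.IsSentence ∧ p φ ∧ φ.code = n}

theorem codes_mono {p q : Fml → Prop} (h : ∀ φ, p φ → q φ) : codes p ≤ codes q :=
  fun _ ⟨φ, h1, h2, h3⟩ => ⟨φ, h1, h φ h2, h3⟩

/-- The combined truth and paradoxicality jump: `T⁺` becomes the set of sentences that hold, `T⁻` the
set of those whose negation holds, `P⁺` the set of those with `𝒫(⌜φ⌝)`, and `P⁻` the set of those with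
`φ ∨ ¬φ`. -/
def jump : Interp →o Interp where
  toFun I :=
    ((codes fun φ => Holds I φ, codes fun φ => Holds I φ.neg),
     (codes fun φ => Holds I (F.par φ.quote), codes fun φ => Holds I (.or φ φ.neg)))
  monotone' := fun _ _ h =>
    ⟨⟨codes_mono fun _ => Holds.mono h, codes_mono fun _ => Holds.mono h⟩,
     ⟨codes_mono fun _ => Holds.mono h, codes_mono fun _ => Holds.mono h⟩⟩

/-- The least fixed point `(T∞, P∞)` of the jump. -/
noncomputable def leastFix : Interp := OrderHom.lfp F.jump

end Syn

/-- The standard structure `(ℕ, T, P)` is a model of a system (given by its derivable sequents): every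
derivable sequent is satisfied. -/
def IsModel (I : Interp) (S : Finset Fml → Finset Fml → Prop) : Prop :=
  ∀ Γ Δ : Finset Fml, S Γ Δ → SeqHolds I (Γ, Δ)

/-- ω-consistency of a system of sequents: there is no `φ(x)` such that the system derives `⇒ ∃ x φ(x)`
and refutes every `φ(n)`, nor such that it refutes `∀ x φ(x)` and derives every `⇒ φ(n)`. Since
`⇒ ¬φ` entails `φ ⇒` by the left negation rule, this covers the formulation with derivable
negations. -/
def OmegaConsistent (S : Finset Fml → Finset Fml → Prop) : Prop :=
  ∀ (φ : Fml) (x : ℕ),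
    ¬ (S ∅ {.ex x φ} ∧ ∀ n : ℕ, S {φ.subst x (Term.numeral n)} ∅) ∧
    ¬ (S {.all x φ} ∅ ∧ ∀ n : ℕ, S ∅ {φ.subst x (Term.numeral n)})

end TruthPar

namespace TruthPar

/-! ### Codes -/

/-! The calculus is sound for every Strong Kleene structure over ℕ in which both predicates have
disjoint extension and anti-extension (`Deriv.sound`); only the left negation rule needs the
disjointness. Two facts about the least fixed point therefore suffice: it satisfies the principles,
and it is consistent.

The principles hold at any fixed point of the jump. Reading the fixed-point equation componentwise,
`T⁺` and `T⁻` collect the sentences that hold and those whose negation holds, `P⁺` those satisfying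
𝒫, and `P⁻` the determinate ones (`sat_T`, `sat_nT`, `sat_P`, `sat_nP`). Each principle then becomes
a Strong Kleene clause or a clause of 𝒫, once the arithmetical formulae have been evaluated
(`holds_par`).

Consistency is the substantial part, since 𝒫 must never catch a determinate sentence. It is carried
by the invariant `Good`: consistency, `I ≤ jump I`, and `T⁺ ∪ T⁻ ⊆ P⁻`. In a good interpretation a
sentence satisfying 𝒫 is neither true nor false (`Good.not_sat_of_par`). For base paradoxical
sentences this is the liar argument, available because base paradoxicality refers only to `PA[SK]`,
which is already sound there. For `T s` and `¬T s` it follows from `P⁺` and `P⁻` being disjoint and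
`T⁺ ∪ T⁻ ⊆ P⁻`. Compound sentences go by induction on depth. Hence the jump preserves `Good`; unions
of chains do too, so a maximal good interpretation below the least fixed point exists by Zorn's
lemma, is closed under the jump, and is the least fixed point.

Finally, ω-consistency needs only a standard model: the quantifiers range over exactly the values of
the numerals. -/

theorem Fn1.index_injective : Function.Injective Fn1.index := by
  intro f g h
  cases f <;> cases g <;> first | rfl | exact absurd h (by decide)

theorem Fn2.index_injective : Function.Injective Fn2.index := by
  intro f g h
  cases f <;> cases g <;> first | rfl | exact absurd h (by decide)

theorem Term.code_injective : Function.Injective Term.code := by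
  intro t
  induction t with
  | var k => intro s h; cases s <;> simp_all [Term.code, Nat.pair_eq_pair]
  | zero => intro s h; cases s <;> simp_all [Term.code, Nat.pair_eq_pair]
  | app1 f t ih =>
    intro s h
    cases s <;> simp only [Term.code, Nat.pair_eq_pair] at h <;> try omega
    obtain ⟨-, h1, h2⟩ := h
    rw [Fn1.index_injective h1, ih h2]
  | app2 f t r ih1 ih2 =>
    intro s h
    cases s <;> simp only [Term.code, Nat.pair_eq_pair] at h <;> try omega
    obtain ⟨-, h1, h2, h3⟩ := h
    rw [Fn2.index_injective h1, ih1 h2, ih2 h3]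

theorem Fml.code_injective : Function.Injective Fml.code := by
  intro φ
  induction φ with
  | eq t s | ne t s | T t | nT t | P t | nP t =>
    intro χ h
    cases χ <;> simp only [Fml.code, Nat.pair_eq_pair] at h <;> try omega
    first
    | rw [Term.code_injective h.2.1, Term.code_injective h.2.2]
    | rw [Term.code_injective h.2]
  | and φ ψ ih1 ih2 | or φ ψ ih1 ih2 =>
    intro χ h
    cases χ <;> simp only [Fml.code, Nat.pair_eq_pair] at h <;> try omega
    rw [ih1 h.2.1, ih2 h.2.2]
  | all k φ ih | ex k φ ih =>
    intro χ h
    cases χ <;> simp only [Fml.code, Nat.pair_eq_pair] at h <;> try omega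
    rw [Term.var.inj (Term.code_injective h.2.1), ih h.2.2]

/-- Injectivity of the coding makes membership of a code a statement about the formula itself, not
about some formula sharing its code. -/
theorem mem_codes {p : Fml → Prop} {φ : Fml} :
    φ.code ∈ Syn.codes p ↔ φ.IsSentence ∧ p φ :=
  ⟨fun ⟨_, h1, h2, h3⟩ => Fml.code_injective h3 ▸ ⟨h1, h2⟩, fun h => ⟨φ, h.1, h.2, rfl⟩⟩

/-! ### Negation -/

namespace Fml

@[simp] theorem neg_neg (φ : Fml) : φ.neg.neg = φ := by
  induction φ <;> simp_all [neg]

@[simp] theorem fv_neg (φ : Fml) : φ.neg.fv = φ.fv := by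
  induction φ <;> simp_all [neg, fv]

theorem isSentence_neg {φ : Fml} : φ.neg.IsSentence ↔ φ.IsSentence := by
  simp [IsSentence]

theorem neg_subst (x : ℕ) (r : Term) (φ : Fml) : (φ.subst x r).neg = φ.neg.subst x r := by
  induction φ with
  | all k φ ih | ex k φ ih => by_cases h : k = x <;> simp [subst, neg, h, ih]
  | _ => simp_all [subst, neg]

end Fml

/-! ### Assignments and substitution -/

theorem Term.eval_congr {e e' : ℕ → ℕ} {t : Term} (h : ∀ k ∈ t.fv, e k = e' k) :
    t.eval e = t.eval e' := by
  induction t with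
  | var k => exact h k (by simp [Term.fv])
  | zero => rfl
  | app1 f t ih => exact congrArg _ (ih h)
  | app2 f t s ih1 ih2 =>
    simp only [Term.eval]
    rw [ih1 fun k hk => h k (by simp [Term.fv, hk]), ih2 fun k hk => h k (by simp [Term.fv, hk])]

theorem Term.eval_update {e : ℕ → ℕ} {t : Term} {k n : ℕ} (h : k ∉ t.fv) :
    t.eval (Function.update e k n) = t.eval e :=
  Term.eval_congr fun j hj => Function.update_of_ne (by rintro rfl; exact h hj) _ _

theorem Term.eval_closed {t : Term} (h : t.fv = ∅) (e e' : ℕ → ℕ) : t.eval e = t.eval e' :=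
  Term.eval_congr (by simp [h])

@[simp] theorem Term.fv_numeral (n : ℕ) : (Term.numeral n).fv = ∅ := by
  induction n <;> simp_all [Term.numeral, Term.fv]

@[simp] theorem Term.eval_numeral (e : ℕ → ℕ) (n : ℕ) : (Term.numeral n).eval e = n := by
  induction n <;> simp_all [Term.numeral, Term.eval, Fn1.eval]

theorem Term.eval_subst (e : ℕ → ℕ) (t : Term) (x : ℕ) (r : Term) :
    (t.subst x r).eval e = t.eval (Function.update e x (r.eval e)) := by
  induction t with
  | var k => by_cases h : k = x <;> simp [Term.subst, Term.eval, h]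
  | zero => rfl
  | app1 f t ih => simp [Term.subst, Term.eval, ih]
  | app2 f t s ih1 ih2 => simp [Term.subst, Term.eval, ih1, ih2]

theorem Term.fv_subst (t : Term) (x : ℕ) (r : Term) :
    (t.subst x r).fv ⊆ t.fv.erase x ∪ r.fv := by
  induction t with
  | var k => by_cases h : k = x <;> simp [Term.subst, Term.fv, h]
  | zero => simp [Term.subst, Term.fv]
  | app1 f t ih => exact ih
  | app2 f t s ih1 ih2 =>
    intro k hk
    have := @ih1 k
    have := @ih2 k
    simp only [Term.subst, Term.fv, Finset.mem_union, Finset.mem_erase] at *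
    tauto

theorem Fml.fv_subst (φ : Fml) (x : ℕ) (r : Term) :
    (φ.subst x r).fv ⊆ φ.fv.erase x ∪ r.fv := by
  induction φ with
  | eq t s | ne t s =>
    intro k hk
    have := @Term.fv_subst t x r k
    have := @Term.fv_subst s x r k
    simp only [subst, fv, Finset.mem_union, Finset.mem_erase] at *
    tauto
  | T t | nT t | P t | nP t => exact Term.fv_subst t x r
  | and φ ψ ih1 ih2 | or φ ψ ih1 ih2 =>
    intro k hk
    have := @ih1 k
    have := @ih2 k
    simp only [subst, fv, Finset.mem_union, Finset.mem_erase] at *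
    tauto
  | all j φ ih | ex j φ ih =>
    intro k hk
    have := @ih k
    by_cases h : j = x
    · simp only [subst, h, if_true, fv, Finset.mem_union, Finset.mem_erase] at *
      tauto
    · simp only [subst, h, if_false, fv, Finset.mem_union, Finset.mem_erase] at *
      tauto

theorem Fml.isSentence_inst {φ : Fml} {k : ℕ} (h : φ.fv.erase k = ∅) (n : ℕ) :
    (φ.subst k (Term.numeral n)).IsSentence := by
  have := φ.fv_subst k (Term.numeral n)
  rwa [h, Term.fv_numeral, Finset.union_empty, Finset.subset_empty] at this

theorem sat_congr {I : Interp} {φ : Fml} :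
    ∀ {e e' : ℕ → ℕ}, (∀ k ∈ φ.fv, e k = e' k) → (Sat I e φ ↔ Sat I e' φ) := by
  induction φ with
  | eq t s | ne t s =>
    intro e e' h
    simp only [Sat]
    rw [Term.eval_congr fun k hk => h k (by simp [Fml.fv, hk]),
      Term.eval_congr (t := s) fun k hk => h k (by simp [Fml.fv, hk])]
  | T t | nT t | P t | nP t =>
    intro e e' h
    simp only [Sat]
    rw [Term.eval_congr h]
  | and φ ψ ih1 ih2 =>
    intro e e' h
    exact and_congr (ih1 fun k hk => h k (by simp [Fml.fv, hk]))
      (ih2 fun k hk => h k (by simp [Fml.fv, hk]))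
  | or φ ψ ih1 ih2 =>
    intro e e' h
    exact or_congr (ih1 fun k hk => h k (by simp [Fml.fv, hk]))
      (ih2 fun k hk => h k (by simp [Fml.fv, hk]))
  | all j φ ih =>
    intro e e' h
    refine forall_congr' fun n => ih fun k hk => ?_
    by_cases hkj : k = j
    · simp [hkj]
    · simpa [hkj] using h k (by simp [Fml.fv, hk, hkj])
  | ex j φ ih =>
    intro e e' h
    refine exists_congr fun n => ih fun k hk => ?_
    by_cases hkj : k = j
    · simp [hkj]
    · simpa [hkj] using h k (by simp [Fml.fv, hk, hkj])

theorem sat_update {I : Interp} {φ : Fml} {e : ℕ → ℕ} {k n : ℕ} (h : k ∉ φ.fv) :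
    Sat I (Function.update e k n) φ ↔ Sat I e φ :=
  sat_congr fun j hj => Function.update_of_ne (by rintro rfl; exact h hj) _ _

theorem Fml.IsSentence.holds_iff {φ : Fml} (h : φ.IsSentence) {I : Interp} (e : ℕ → ℕ) :
    Holds I φ ↔ Sat I e φ :=
  ⟨fun H => H e, fun H e' => (sat_congr (by rw [h]; simp)).1 H⟩

theorem Term.subst_eq_self {t : Term} {x : ℕ} {r : Term} (h : x ∉ t.fv) :
    t.subst x r = t := by
  induction t with
  | var k => exact if_neg fun hk => h (by simp [Term.fv, hk])
  | zero => rfl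
  | app1 f t ih => exact congrArg _ (ih h)
  | app2 f t s ih1 ih2 =>
    simp only [Term.fv, Finset.mem_union, not_or] at h
    rw [Term.subst, ih1 h.1, ih2 h.2]

theorem Fml.subst_eq_self {φ : Fml} {x : ℕ} {r : Term} (h : x ∉ φ.fv) : φ.subst x r = φ := by
  induction φ with
  | eq t s | ne t s =>
    simp only [fv, Finset.mem_union, not_or] at h
    rw [subst, Term.subst_eq_self h.1, Term.subst_eq_self h.2]
  | T t | nT t | P t | nP t => rw [subst, Term.subst_eq_self h]
  | and φ ψ ih1 ih2 | or φ ψ ih1 ih2 =>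
    simp only [fv, Finset.mem_union, not_or] at h
    rw [subst, ih1 h.1, ih2 h.2]
  | all j φ ih | ex j φ ih =>
    by_cases hj : j = x
    · simp [subst, hj]
    · have : x ∉ φ.fv := fun hx => h (by simp [fv, hx, Ne.symm hj])
      simp [subst, ih this]

/-- At a quantifier either `x` is not free, and neither side depends on it, or the bound variable
differs from `x` and is absent from `r`, so that the two updates commute. -/
theorem sat_subst {I : Interp} {φ : Fml} {x : ℕ} {r : Term} :
    ∀ {e : ℕ → ℕ}, φ.FreeFor r x →
      (Sat I e (φ.subst x r) ↔ Sat I (Function.update e x (r.eval e)) φ) := by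
  induction φ with
  | eq t s | ne t s | T t | nT t | P t | nP t =>
    intro e _
    simp only [Fml.subst, Sat, Term.eval_subst]
  | and φ ψ ih1 ih2 => exact fun h => and_congr (ih1 h.1) (ih2 h.2)
  | or φ ψ ih1 ih2 => exact fun h => or_congr (ih1 h.1) (ih2 h.2)
  | all j φ ih =>
    intro e h
    by_cases hx : x ∈ (Fml.all j φ).fv
    · obtain ⟨h1, h2⟩ := h.resolve_left (not_not.2 hx)
      have hjx : j ≠ x := fun hj => by simp [Fml.fv, hj] at hx
      simp only [Fml.subst, if_neg hjx, Sat]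
      refine forall_congr' fun n => ?_
      rw [ih h2, Term.eval_update h1, Function.update_comm hjx]
    · rw [Fml.subst_eq_self hx, sat_update hx]
  | ex j φ ih =>
    intro e h
    by_cases hx : x ∈ (Fml.ex j φ).fv
    · obtain ⟨h1, h2⟩ := h.resolve_left (not_not.2 hx)
      have hjx : j ≠ x := fun hj => by simp [Fml.fv, hj] at hx
      simp only [Fml.subst, if_neg hjx, Sat]
      refine exists_congr fun n => ?_
      rw [ih h2, Term.eval_update h1, Function.update_comm hjx]
    · rw [Fml.subst_eq_self hx, sat_update hx]

/-- The only variable that could be captured is `x`, and below a quantifier binding `x` nothing is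
substituted. This covers numerals and the term `S x` of the induction rule. -/
theorem Fml.freeFor_of_fv_subset {r : Term} {x : ℕ} (hr : r.fv ⊆ {x}) (φ : Fml) :
    φ.FreeFor r x := by
  induction φ with
  | eq | ne | T | nT | P | nP => trivial
  | and φ ψ ih1 ih2 | or φ ψ ih1 ih2 => exact ⟨ih1, ih2⟩
  | all j φ ih | ex j φ ih =>
    by_cases hj : j = x
    · exact Or.inl (by simp [fv, hj])
    · exact Or.inr ⟨fun h => hj (by simpa using hr h), ih⟩

theorem sat_inst {I : Interp} {φ : Fml} {k n : ℕ} {e : ℕ → ℕ} :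
    Sat I e (φ.subst k (Term.numeral n)) ↔ Sat I (Function.update e k n) φ := by
  rw [sat_subst (φ.freeFor_of_fv_subset (by simp)), Term.eval_numeral]

/-! ### Soundness of the calculus -/

/-- The extensions of the predicates are disjoint from their anti-extensions. -/
def Consistent (I : Interp) : Prop := Disjoint I.1.1 I.1.2 ∧ Disjoint I.2.1 I.2.2

theorem Consistent.not_sat_neg {I : Interp} (hI : Consistent I) {φ : Fml} :
    ∀ {e : ℕ → ℕ}, Sat I e φ → ¬ Sat I e φ.neg := by
  have hT := Set.disjoint_left.1 hI.1
  have hP := Set.disjoint_left.1 hI.2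
  induction φ with
  | eq t s => exact fun h h' => h' h
  | ne t s => exact fun h h' => h h'
  | T t => exact fun h h' => hT h h'
  | nT t => exact fun h h' => hT h' h
  | P t => exact fun h h' => hP h h'
  | nP t => exact fun h h' => hP h' h
  | and φ ψ ih1 ih2 => exact fun h h' => h'.elim (ih1 h.1) (ih2 h.2)
  | or φ ψ ih1 ih2 => exact fun h h' => h.elim (fun h => ih1 h h'.1) fun h => ih2 h h'.2
  | all k φ ih => exact fun h ⟨n, h'⟩ => ih (h n) h'
  | ex k φ ih => exact fun ⟨n, h⟩ h' => ih h (h' n)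

/-- The eigenvariable may coincide with the bound variable, hence the condition on `φ.fv.erase x`
and not on `φ.fv`. -/
theorem sat_update_eigen {I : Interp} {φ : Fml} {x u n : ℕ} {e : ℕ → ℕ}
    (h : φ.FreeFor (.var u) x) (hu : u ∉ φ.fv.erase x) :
    Sat I (Function.update e u n) (φ.subst x (.var u)) ↔ Sat I (Function.update e x n) φ := by
  rw [sat_subst h]
  refine sat_congr fun k hk => ?_
  by_cases hkx : k = x
  · simp [hkx, Term.eval]
  · have hku : k ≠ u := fun hku => hu (by simp [← hku, hk, hkx])
    simp [hkx, hku]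

/-- Consistency enters only in `negL`, where it excludes that a formula and its negation are both
satisfied. No completeness of the predicates is needed, because there is no right negation rule. -/
theorem Deriv.sound {I : Interp} (hI : Consistent I) {Ax : Set Sequent}
    (hAx : ∀ S ∈ Ax, SeqHolds I S) {Γ Δ : Finset Fml} (h : Deriv Ax Γ Δ) :
    SeqHolds I (Γ, Δ) := by
  induction h with
  | ax h => exact hAx _ h
  | init φ => exact fun e h => ⟨φ, by simp, h φ (by simp)⟩
  | negL _ ih =>
    intro e h
    simp only [Finset.forall_mem_insert] at h
    have := ih e h.2
    simp only [Finset.exists_mem_insert] at this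
    exact this.resolve_left fun hφ => hI.not_sat_neg hφ h.1
  | cut _ _ ih1 ih2 =>
    intro e h
    have := ih1 e h
    simp only [Finset.exists_mem_insert] at this
    exact this.elim (fun hφ => ih2 e (by simpa only [Finset.forall_mem_insert] using ⟨hφ, h⟩)) id
  | weakL φ _ ih =>
    intro e h
    simp only [Finset.forall_mem_insert] at h
    exact ih e h.2
  | weakR φ _ ih =>
    intro e h
    simp only [Finset.exists_mem_insert]
    exact Or.inr (ih e h)
  | orL _ _ ih1 ih2 =>
    intro e h
    have ih1 := ih1 e
    have ih2 := ih2 e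
    simp only [Finset.forall_mem_insert, Sat] at h ih1 ih2
    exact h.1.elim (fun hφ => ih1 ⟨hφ, h.2⟩) fun hψ => ih2 ⟨hψ, h.2⟩
  | orR _ ih =>
    intro e h
    have := ih e h
    simp only [Finset.exists_mem_insert, Sat] at this ⊢
    rwa [or_assoc]
  | andL _ ih =>
    intro e h
    have ih := ih e
    simp only [Finset.forall_mem_insert, Sat] at h ih
    exact ih ⟨h.1.1, h.1.2, h.2⟩
  | andR _ _ ih1 ih2 =>
    intro e h
    have h1 := ih1 e h
    have h2 := ih2 e h
    simp only [Finset.exists_mem_insert, Sat] at h1 h2 ⊢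
    tauto
  | @exL Γ Δ φ x u hf hu hfr _ ih =>
    intro e h
    simp only [Finset.forall_mem_insert] at h
    obtain ⟨⟨n, hn⟩, hΓ⟩ := h
    obtain ⟨δ, hδ, hs⟩ := ih (Function.update e u n) (by
      simp only [Finset.forall_mem_insert]
      exact ⟨(sat_update_eigen hf hu).2 hn,
        fun γ hγ => (sat_update (hfr γ (Finset.mem_union_left _ hγ))).2 (hΓ γ hγ)⟩)
    exact ⟨δ, hδ, (sat_update (hfr δ (Finset.mem_union_right _ hδ))).1 hs⟩
  | exR hf _ ih =>
    intro e h
    have := ih e h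
    simp only [Finset.exists_mem_insert, sat_subst hf] at this ⊢
    exact this.imp_left fun hs => ⟨_, hs⟩
  | allL hf _ ih =>
    intro e h
    have ih := ih e
    simp only [Finset.forall_mem_insert, sat_subst hf] at h ih
    exact ih ⟨h.1 _, h.2⟩
  | @allR Γ Δ φ x u hf hu hfr _ ih =>
    intro e h
    simp only [Finset.exists_mem_insert]
    -- The satisfied formula on the right might vary with `n`. Assuming that nothing in `Δ` is
    -- satisfied, which by freshness does not depend on the value of `u`, leaves the instance of `φ`
    -- for every `n`.
    by_contra hcon
    rw [not_or] at hcon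
    refine hcon.1 fun n => ?_
    have := ih (Function.update e u n)
      fun γ hγ => (sat_update (hfr γ (Finset.mem_union_left _ hγ))).2 (h γ hγ)
    simp only [Finset.exists_mem_insert, sat_update_eigen hf hu] at this
    refine this.resolve_right fun ⟨δ, hδ, hs⟩ => hcon.2 ⟨δ, hδ, ?_⟩
    exact (sat_update (hfr δ (Finset.mem_union_right _ hδ))).1 hs
  | ref t => exact fun e _ => ⟨_, Finset.mem_insert_self _ _, rfl⟩
  | @repl Γ Δ φ x s t hs ht _ ih =>
    intro e h
    have := ih e h
    simp only [Finset.exists_mem_insert, sat_subst hs, sat_subst ht] at this ⊢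
    -- Identity is bivalent: either `s ≠ t` is satisfied or the two instances are evaluated alike.
    by_cases hst : s.eval e = t.eval e
    · rw [hst]; exact Or.inr this
    · exact Or.inl hst
  | @ind Γ Δ φ u t hf hfr _ ih =>
    intro e h
    simp only [Finset.forall_mem_insert, Finset.exists_mem_insert] at h ⊢
    rw [sat_subst (φ.freeFor_of_fv_subset (by simp [Term.fv])), Term.eval] at h
    by_contra hcon
    rw [not_or, sat_subst hf] at hcon
    refine hcon.1 ?_
    -- With no member of `Δ` satisfied, the premise gives the successor step at every standard
    -- number, so ordinary induction on ℕ applies.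
    have key : ∀ n, Sat I (Function.update e u n) φ := by
      intro n
      induction n with
      | zero => exact h.1
      | succ n ihn =>
        have := ih (Function.update e u n) (by
          simp only [Finset.forall_mem_insert]
          exact ⟨ihn, fun γ hγ =>
            (sat_update (hfr γ (Finset.mem_union_left _ hγ))).2 (h.2 γ hγ)⟩)
        simp only [Finset.exists_mem_insert] at this
        rw [sat_subst (φ.freeFor_of_fv_subset (by simp [Term.fv]))] at this
        have h' := this.resolve_right fun ⟨δ, hδ, hs⟩ =>
          hcon.2 ⟨δ, hδ, (sat_update (hfr δ (Finset.mem_union_right _ hδ))).1 hs⟩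
        simpa [Term.eval, Fn1.eval] using h'
    exact key _

theorem PAInit.seqHolds {S : Sequent} (h : PAInit S) (I : Interp) : SeqHolds I S := by
  intro e hΓ
  cases h with
  | succ_ne t => simp [Sat, Term.eval, Fn1.eval] at hΓ
  | succ_inj t s => simpa [Sat, Term.eval, Fn1.eval] using hΓ
  | pair_lt a c b hb =>
    subst hb
    -- This selects the first branch of the case distinction defining `Nat.pair`.
    have : a.eval e < a.eval e + (c.eval e + 1) := by omega
    simp [Sat, Term.eval, Fn1.eval, Fn2.eval, Nat.pair, this]
  | pair_ge b c a ha =>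
    subst ha
    have : ¬ b.eval e + c.eval e < b.eval e := by omega
    simp [Sat, Term.eval, Fn2.eval, Nat.pair]
  | num_zero => simp [Sat, Term.eval, Fn1.eval, Term.numeral]
  | num_succ t =>
    simp [Sat, Term.eval, Fn1.eval, Fn2.eval, Term.numeral, Term.code]
  | _ => simp [Sat, Term.eval, Fn1.eval, Fn2.eval, Nat.add_assoc, Nat.mul_succ]

theorem PASK.sound {I : Interp} (hI : Consistent I) {Γ Δ : Finset Fml} (h : PASK Γ Δ) :
    SeqHolds I (Γ, Δ) :=
  Deriv.sound hI (fun _ hS => PAInit.seqHolds hS I) h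

/-- A witness of the existential is named by a numeral, and all numeral instances together give the
universal. In both cases a derivable sequent with empty right side would have a satisfied left side.
-/
theorem IsModel.omegaConsistent {I : Interp} {S : Finset Fml → Finset Fml → Prop}
    (h : IsModel I S) : OmegaConsistent S := by
  refine fun φ x => ⟨fun ⟨h1, h2⟩ => ?_, fun ⟨h1, h2⟩ => ?_⟩
  · have := h _ _ h1 0 (by simp)
    simp only [Finset.mem_singleton, exists_eq_left, Sat] at this
    obtain ⟨n, hn⟩ := this
    have := h _ _ (h2 n) 0 (by simpa using sat_inst.2 hn)
    simp at this
  · have := h _ _ h1 0 (by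
      simp only [Finset.mem_singleton, forall_eq]
      intro n
      have := h _ _ (h2 n) 0 (by simp)
      simp only [Finset.mem_singleton, exists_eq_left] at this
      exact sat_inst.1 this)
    simp at this

/-! ### Substitution into the chosen formulae -/

/-- All bound variables have index below `N`. -/
def Fml.BdBelow (N : ℕ) : Fml → Prop
  | and φ ψ => φ.BdBelow N ∧ ψ.BdBelow N
  | or φ ψ => φ.BdBelow N ∧ ψ.BdBelow N
  | all k φ => k < N ∧ φ.BdBelow N
  | ex k φ => k < N ∧ φ.BdBelow N
  | _ => True

theorem Fml.bdBelow_of_bound_le {N : ℕ} {φ : Fml} (h : φ.bound ≤ N) : φ.BdBelow N := by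
  induction φ with
  | eq | ne | T | nT | P | nP => trivial
  | and φ ψ ih1 ih2 | or φ ψ ih1 ih2 =>
    simp only [bound, max_le_iff] at h
    exact ⟨ih1 h.1, ih2 h.2⟩
  | all k φ ih | ex k φ ih =>
    simp only [bound, max_le_iff] at h
    exact ⟨h.1, ih h.2⟩

/-- Substitution may raise `Fml.bound` by bringing in new free variables, but leaves the bound
variables alone. Hence iterated substitutions are controlled by `BdBelow`. -/
theorem Fml.BdBelow.subst {N : ℕ} {φ : Fml} (h : φ.BdBelow N) (x : ℕ) (r : Term) :
    (φ.subst x r).BdBelow N := by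
  induction φ with
  | eq | ne | T | nT | P | nP => trivial
  | and φ ψ ih1 ih2 | or φ ψ ih1 ih2 => exact ⟨ih1 h.1, ih2 h.2⟩
  | all k φ ih | ex k φ ih =>
    by_cases hk : k = x
    · simpa [Fml.subst, hk] using h
    · rw [Fml.subst, if_neg hk]
      exact ⟨h.1, ih h.2⟩

theorem Fml.BdBelow.freeFor {N : ℕ} {φ : Fml} (h : φ.BdBelow N) {r : Term}
    (hr : ∀ k ∈ r.fv, N ≤ k) (x : ℕ) : φ.FreeFor r x := by
  induction φ with
  | eq | ne | T | nT | P | nP => trivial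
  | and φ ψ ih1 ih2 | or φ ψ ih1 ih2 => exact ⟨ih1 h.1, ih2 h.2⟩
  | all k φ ih | ex k φ ih => exact Or.inr ⟨fun hk => absurd h.1 (hr k hk).not_gt, ih h.2⟩

namespace Syn

variable (F : Syn)

@[simp] theorem ix_inj {i j : ℕ} : F.ix i = F.ix j ↔ i = j := by simp [ix]

@[simp] theorem eval_v (e : ℕ → ℕ) (i : ℕ) : (F.v i).eval e = e (F.ix i) := rfl

/-- All variables of the term have index at least `F.off`. -/
def Avoids (t : Term) : Prop := ∀ k ∈ t.fv, F.off ≤ k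

/-- All variables of the term are among the first ten of those reserved for display. -/
def Displayed (t : Term) : Prop := ∀ k ∈ t.fv, ∃ i < 10, k = F.ix i

variable {F}

theorem avoids_v (i : ℕ) : F.Avoids (F.v i) := by simp [Avoids, v, Term.fv, ix]

theorem displayed_v {i : ℕ} (hi : i < 10) : F.Displayed (F.v i) := by
  intro k hk
  exact ⟨i, hi, by simpa [v, Term.fv] using hk⟩

theorem Displayed.app1 {t : Term} (h : F.Displayed t) (f : Fn1) : F.Displayed (.app1 f t) := h

theorem Displayed.app2 {t s : Term} (ht : F.Displayed t) (hs : F.Displayed s) (f : Fn2) :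
    F.Displayed (.app2 f t s) :=
  fun k hk => (Finset.mem_union.1 hk).elim (ht k) (hs k)

theorem displayed_of_closed {t : Term} (h : t.fv = ∅) : F.Displayed t := by simp [Displayed, h]

theorem Displayed.avoids {t : Term} (h : F.Displayed t) : F.Avoids t := by
  intro k hk
  obtain ⟨i, -, rfl⟩ := h k hk
  exact Nat.le_add_right _ _

theorem Displayed.eval_update {t : Term} (h : F.Displayed t) {i : ℕ} (hi : 10 ≤ i) (e : ℕ → ℕ)
    (n : ℕ) : t.eval (Function.update e (F.ix i) n) = t.eval e := by
  refine Term.eval_update fun hk => ?_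
  obtain ⟨j, hj, hij⟩ := h _ hk
  have := F.ix_inj.1 hij
  omega

theorem four_le_off : 4 ≤ F.off := le_max_left _ _

/-- The inserted terms do not contain `v₀, …, v₃`, so the successive substitutions in `valF`, `negF`
and `subF` act like a simultaneous one. -/
theorem Avoids.eval_update {t : Term} (h : F.Avoids t) {k : ℕ} (hk : k < 4) (e : ℕ → ℕ) (n : ℕ) :
    t.eval (Function.update e k n) = t.eval e :=
  Term.eval_update fun hkt => absurd (four_le_off.trans (h k hkt)) (by omega)

theorem sat_subst_avoids {I : Interp} {e : ℕ → ℕ} {φ : Fml} (hφ : φ.BdBelow F.off) {r : Term}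
    (hr : F.Avoids r) (x : ℕ) :
    Sat I e (φ.subst x r) ↔ Sat I (Function.update e x (r.eval e)) φ :=
  sat_subst (hφ.freeFor hr x)

/-! ### Satisfaction of the representing formulae at terms -/

variable {I : Interp} {e : ℕ → ℕ}

theorem sat_clTmF (hF : F.Represents) {t : Term} (ht : F.Avoids t) :
    Sat I e (F.clTmF t) ↔ ∃ c : Term, c.fv = ∅ ∧ c.code = t.eval e := by
  rw [clTmF, sat_subst_avoids (Fml.bdBelow_of_bound_le (by simp [off])) ht, hF.clTm_iff]
  simp

theorem sat_sentF (hF : F.Represents) {t : Term} (ht : F.Avoids t) :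
    Sat I e (F.sentF t) ↔ ∃ φ : Fml, φ.IsSentence ∧ φ.code = t.eval e := by
  rw [sentF, sat_subst_avoids (Fml.bdBelow_of_bound_le (by simp [off])) ht, hF.sent_iff]
  simp

theorem sat_BF (hF : F.Represents) {t : Term} (ht : F.Avoids t) :
    Sat I e (F.BF t) ↔ ∃ φ : Fml, BaseParadoxical φ ∧ φ.code = t.eval e := by
  rw [BF, sat_subst_avoids (Fml.bdBelow_of_bound_le (by simp [off])) ht, hF.B_iff]
  simp

theorem sat_valF (hF : F.Represents) {t s c : Term} (ht : F.Avoids t) (hs : F.Avoids s)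
    (hc : c.fv = ∅) (htc : t.eval e = c.code) :
    Sat I e (F.valF t s) ↔ s.eval e = c.eval 0 := by
  have hb : F.val.BdBelow F.off := Fml.bdBelow_of_bound_le (by simp [off])
  rw [valF, sat_subst_avoids (hb.subst _ _) hs, sat_subst_avoids hb ht,
    ht.eval_update (by omega), hF.val_iff I _ c hc (by simpa using htc), Term.eval_closed hc _ 0]
  simp

theorem sat_negF (hF : F.Represents) {t s : Term} {φ : Fml} (ht : F.Avoids t) (hs : F.Avoids s)
    (h : t.eval e = φ.code) : Sat I e (F.negF t s) ↔ s.eval e = φ.neg.code := by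
  have hb : F.neg.BdBelow F.off := Fml.bdBelow_of_bound_le (by simp [off])
  rw [negF, sat_subst_avoids (hb.subst _ _) hs, sat_subst_avoids hb ht,
    ht.eval_update (by omega), hF.neg_iff I _ φ (by simpa using h)]
  simp

theorem sat_subF (hF : F.Represents) {x t z w c : Term} {φ : Fml} {k : ℕ} (hx : F.Avoids x)
    (ht : F.Avoids t) (hz : F.Avoids z) (hw : F.Avoids w) (hc : c.fv = ∅)
    (hxφ : x.eval e = φ.code) (htc : t.eval e = c.code) (hzk : z.eval e = (Term.var k).code) :
    Sat I e (F.subF x t z w) ↔ w.eval e = (φ.subst k c).code := by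
  have hb : F.sub.BdBelow F.off := Fml.bdBelow_of_bound_le (by simp [off])
  rw [subF, sat_subst_avoids (((hb.subst _ _).subst _ _).subst _ _) hw,
    sat_subst_avoids ((hb.subst _ _).subst _ _) hz, sat_subst_avoids (hb.subst _ _) ht,
    sat_subst_avoids hb hx]
  simp only [hz.eval_update (show 3 < 4 by omega), ht.eval_update (show 3 < 4 by omega),
    ht.eval_update (show 2 < 4 by omega), hx.eval_update (show 3 < 4 by omega),
    hx.eval_update (show 2 < 4 by omega), hx.eval_update (show 1 < 4 by omega)]
  rw [hF.sub_iff I _ φ c k hc (by simpa using hxφ) (by simpa using htc) (by simpa using hzk)]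
  simp

/-! ### The functional notation -/

/-- The graph formula admits exactly one value, so the auxiliary quantifier collapses. The predicate
`p` stands for the meaning of `A` at the auxiliary variable; displayed variables have indices below
10 and cannot clash with it. -/
theorem sat_atVal (hF : F.Represents) {A : Term → Fml} {s c : Term} {p : ℕ → Prop}
    (hs : F.Displayed s) (hc : c.fv = ∅) (hsc : s.eval e = c.code)
    (hA : ∀ n, Sat I (Function.update e (F.ix 10) n) (A (F.v 10)) ↔ p n) :
    Sat I e (F.atVal A s) ↔ p (c.eval 0) := by
  have h : ∀ n, Sat I (Function.update e (F.ix 10) n) (F.valF s (F.v 10)) ↔ n = c.eval 0 :=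
    fun n => by
      rw [sat_valF hF hs.avoids (avoids_v _) hc (by rwa [hs.eval_update le_rfl])]
      simp
  simp only [atVal, Sat, h, hA, exists_eq_left]

theorem sat_atVal2 (hF : F.Represents) {R : Term → Term → Fml} {s t c d : Term}
    {r : ℕ → ℕ → Prop} (hs : F.Displayed s) (ht : F.Displayed t) (hc : c.fv = ∅) (hd : d.fv = ∅)
    (hsc : s.eval e = c.code) (htd : t.eval e = d.code)
    (hR : ∀ m n, Sat I (Function.update (Function.update e (F.ix 10) m) (F.ix 11) n)
      (R (F.v 10) (F.v 11)) ↔ r m n) :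
    Sat I e (F.atVal2 R s t) ↔ r (c.eval 0) (d.eval 0) := by
  have h1 : ∀ m n, Sat I (Function.update (Function.update e (F.ix 10) m) (F.ix 11) n)
      (F.valF s (F.v 10)) ↔ m = c.eval 0 := fun m n => by
    rw [sat_valF hF hs.avoids (avoids_v _) hc
      (by rwa [hs.eval_update (by omega), hs.eval_update le_rfl])]
    simp
  have h2 : ∀ m n, Sat I (Function.update (Function.update e (F.ix 10) m) (F.ix 11) n)
      (F.valF t (F.v 11)) ↔ n = d.eval 0 := fun m n => by
    rw [sat_valF hF ht.avoids (avoids_v _) hd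
      (by rwa [ht.eval_update (by omega), ht.eval_update le_rfl])]
    simp
  simp only [atVal2, Sat, h1, h2, hR]
  constructor
  · rintro ⟨_, _, ⟨rfl, rfl⟩, h⟩
    exact h
  · exact fun h => ⟨_, _, ⟨rfl, rfl⟩, h⟩

theorem sat_atNeg (hF : F.Represents) {A : Term → Fml} {x : Term} {φ : Fml} {p : ℕ → Prop}
    (hx : F.Displayed x) (hxφ : x.eval e = φ.code)
    (hA : ∀ n, Sat I (Function.update e (F.ix 12) n) (A (F.v 12)) ↔ p n) :
    Sat I e (F.atNeg A x) ↔ p φ.neg.code := by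
  have h : ∀ n, Sat I (Function.update e (F.ix 12) n) (F.negF x (F.v 12)) ↔ n = φ.neg.code :=
    fun n => by
      rw [sat_negF hF hx.avoids (avoids_v _) ((hx.eval_update (by omega) _ _).trans hxφ)]
      simp
  simp only [atNeg, Sat, h, hA, exists_eq_left]

theorem sat_atInst (hF : F.Represents) {A : Term → Fml} {x y z : Term} {φ : Fml} {k : ℕ}
    {p : ℕ → Prop} (hx : F.Displayed x) (hy : F.Displayed y) (hz : F.Displayed z)
    (hxφ : x.eval e = φ.code) (hzk : z.eval e = (Term.var k).code)
    (hA : ∀ n, Sat I (Function.update e (F.ix 13) n) (A (F.v 13)) ↔ p n) :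
    Sat I e (F.atInst A x y z) ↔ p (φ.subst k (Term.numeral (y.eval e))).code := by
  have h : ∀ n, Sat I (Function.update e (F.ix 13) n)
      (F.subF x (.app1 .num y) z (F.v 13)) ↔
        n = (φ.subst k (Term.numeral (y.eval e))).code := fun n => by
    -- The substituted closed term is the numeral of the value of `y`, whose code is by definition
    -- the value of `num(y)`.
    rw [sat_subF hF hx.avoids (hy.app1 _).avoids hz.avoids (avoids_v _) (Term.fv_numeral _)
      ((hx.eval_update (by omega) _ _).trans hxφ)
      ((hy.app1 _).eval_update (by omega) _ _) ((hz.eval_update (by omega) _ _).trans hzk)]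
    simp
  simp only [atInst, Sat, h, hA, exists_eq_left]

theorem sat_Pi (hF : F.Represents) {x : Term} {φ : Fml} (hx : F.Displayed x)
    (hxφ : x.eval e = φ.code) :
    Sat I e (F.Pi x) ↔ BaseParadoxical φ ∨ BaseParadoxical φ.neg := by
  have h : ∀ (χ : Fml), (∃ ψ, BaseParadoxical ψ ∧ ψ.code = χ.code) ↔ BaseParadoxical χ :=
    fun χ => ⟨fun ⟨ψ, h1, h2⟩ => Fml.code_injective h2 ▸ h1, fun h => ⟨χ, h, rfl⟩⟩
  refine or_congr ?_ ?_
  · rw [sat_BF hF hx.avoids, hxφ, h]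
  · rw [sat_atNeg hF (p := fun n => ∃ ψ, BaseParadoxical ψ ∧ ψ.code = n) hx hxφ
      fun n => by simp [sat_BF hF (avoids_v _)], h]

/-! ### The closure conditions of paradoxicality -/

/-- The closure conditions of paradoxicality other than `Π`, by the form of the formula. -/
def ParCond (I : Interp) : Fml → Prop
  | .T s => s.eval 0 ∈ I.2.1
  | .nT s => s.eval 0 ∈ I.2.1
  | .and φ ψ => (φ.code ∈ I.2.1 ∧ ψ.code ∈ I.2.1) ∨ (φ.code ∈ I.1.1 ∧ ψ.code ∈ I.2.1) ∨
      (ψ.code ∈ I.1.1 ∧ φ.code ∈ I.2.1)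
  | .or φ ψ => (φ.code ∈ I.2.1 ∧ ψ.code ∈ I.2.1) ∨ (φ.code ∈ I.1.2 ∧ ψ.code ∈ I.2.1) ∨
      (ψ.code ∈ I.1.2 ∧ φ.code ∈ I.2.1)
  | .all k φ => (∃ n, (φ.subst k (Term.numeral n)).code ∈ I.2.1) ∧
      ∀ n, (φ.subst k (Term.numeral n)).code ∈ I.2.1 ∨ (φ.subst k (Term.numeral n)).code ∈ I.1.1
  | .ex k φ => (∃ n, (φ.subst k (Term.numeral n)).code ∈ I.2.1) ∧
      ∀ n, (φ.subst k (Term.numeral n)).code ∈ I.2.1 ∨ (φ.subst k (Term.numeral n)).code ∈ I.1.2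
  | _ => False

theorem sat_atInst_v (hF : F.Represents) {i j k : ℕ} {φ : Fml} (hi : i < 6) (hj : j < 6)
    (hφ : e (F.ix i) = φ.code) (hk : e (F.ix j) = (Term.var k).code) {A : Term → Fml} {X : Set ℕ}
    (hA : ∀ (e' : ℕ → ℕ) (t : Term), Sat I e' (A t) ↔ t.eval e' ∈ X) (n : ℕ) :
    Sat I (Function.update e (F.ix 6) n) (F.atInst A (F.v i) (F.v 6) (F.v j)) ↔
      (φ.subst k (Term.numeral n)).code ∈ X := by
  rw [sat_atInst hF (p := (· ∈ X)) (φ := φ) (k := k) (displayed_v (by omega))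
    (displayed_v (by omega)) (displayed_v (by omega)) (by simpa [hi.ne] using hφ)
    (by simpa [hj.ne] using hk) (by simp [hA])]
  simp

theorem sat_allClause (hF : F.Represents) {i j k : ℕ} {φ : Fml} (hi : i < 6) (hj : j < 6)
    (hφ : e (F.ix i) = φ.code) (hk : e (F.ix j) = (Term.var k).code) :
    Sat I e (F.allClause (F.v i) (F.v j)) ↔ ParCond I (.all k φ) := by
  have hP := sat_atInst_v (I := I) hF hi hj hφ hk (A := .P) fun _ _ => Iff.rfl
  have hT := sat_atInst_v (I := I) hF hi hj hφ hk (A := .T) fun _ _ => Iff.rfl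
  simp only [allClause, Sat, ParCond, hP, hT]

theorem sat_exClause (hF : F.Represents) {i j k : ℕ} {φ : Fml} (hi : i < 6) (hj : j < 6)
    (hφ : e (F.ix i) = φ.code) (hk : e (F.ix j) = (Term.var k).code) :
    Sat I e (F.exClause (F.v i) (F.v j)) ↔ ParCond I (.ex k φ) := by
  have hP := sat_atInst_v (I := I) hF hi hj hφ hk (A := .P) fun _ _ => Iff.rfl
  have hT := sat_atInst_v (I := I) hF hi hj hφ hk (A := .nT) fun _ _ => Iff.rfl
  simp only [exClause, Sat, ParCond, hP, hT]

theorem sat_andClause {y z : Term} {φ ψ : Fml} (hy : y.eval e = φ.code) (hz : z.eval e = ψ.code) :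
    Sat I e (andClause y z) ↔ ParCond I (.and φ ψ) := by
  simp [andClause, Sat, ParCond, hy, hz]

theorem sat_orClause {y z : Term} {φ ψ : Fml} (hy : y.eval e = φ.code) (hz : z.eval e = ψ.code) :
    Sat I e (orClause y z) ↔ ParCond I (.or φ ψ) := by
  simp [orClause, Sat, ParCond, hy, hz]

end Syn

/-! ### Decoding -/

theorem Fml.IsSentence.of_and {φ ψ : Fml} (h : (Fml.and φ ψ).IsSentence) :
    φ.IsSentence ∧ ψ.IsSentence := Finset.union_eq_empty.1 h

theorem Fml.IsSentence.of_or {φ ψ : Fml} (h : (Fml.or φ ψ).IsSentence) :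
    φ.IsSentence ∧ ψ.IsSentence := Finset.union_eq_empty.1 h

theorem Fml.exists_eq_T {φ : Fml} {a : ℕ} (h : φ.code = Nat.pair 6 a) :
    ∃ t, φ = .T t ∧ t.code = a := by
  cases φ <;> simp_all [code, Nat.pair_eq_pair]

theorem Fml.exists_eq_and {φ : Fml} {a b : ℕ} (h : φ.code = Nat.pair 10 (Nat.pair a b)) :
    ∃ ψ χ, φ = .and ψ χ ∧ ψ.code = a ∧ χ.code = b := by
  cases φ <;> simp_all [code, Nat.pair_eq_pair]

theorem Fml.exists_eq_or {φ : Fml} {a b : ℕ} (h : φ.code = Nat.pair 11 (Nat.pair a b)) :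
    ∃ ψ χ, φ = .or ψ χ ∧ ψ.code = a ∧ χ.code = b := by
  cases φ <;> simp_all [code, Nat.pair_eq_pair]

theorem Fml.exists_eq_all {φ : Fml} {a b : ℕ} (h : φ.code = Nat.pair 12 (Nat.pair a b)) :
    ∃ k ψ, φ = .all k ψ ∧ (Term.var k).code = a ∧ ψ.code = b := by
  cases φ <;> simp_all [code, Nat.pair_eq_pair]

theorem Fml.exists_eq_ex {φ : Fml} {a b : ℕ} (h : φ.code = Nat.pair 13 (Nat.pair a b)) :
    ∃ k ψ, φ = .ex k ψ ∧ (Term.var k).code = a ∧ ψ.code = b := by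
  cases φ <;> simp_all [code, Nat.pair_eq_pair]

namespace Syn

variable {F : Syn} {I : Interp} {e : ℕ → ℕ}

/-! ### The disjuncts of 𝒫 at the name of a sentence -/

theorem sat_sentF_quote (hF : F.Represents) {φ : Fml} (h : φ.IsSentence) :
    Sat I e (F.sentF (Term.numeral φ.code)) :=
  (sat_sentF hF (displayed_of_closed (Term.fv_numeral _)).avoids).2
    ⟨φ, h, (Term.eval_numeral _ _).symm⟩

theorem sat_par2 (hF : F.Represents) {φ : Fml} (h : φ.IsSentence) :
    Sat I e (F.par2 φ.quote) ↔ ∃ s : Term, φ = .T s ∧ ParCond I φ := by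
  simp only [par2, Sat, sat_sentF_quote hF h, true_and, Fml.quote, Term.eval_numeral, Term.eval,
    Fn1.eval, eval_v, Function.update_self, sat_clTmF hF (avoids_v _)]
  constructor
  · rintro ⟨n, ⟨c, hc, hcn⟩, hφ, hP⟩
    obtain ⟨t, rfl, ht⟩ := Fml.exists_eq_T hφ
    obtain rfl := Term.code_injective (hcn.trans ht.symm)
    exact ⟨c, rfl, (sat_atVal hF (p := (· ∈ I.2.1)) (displayed_v (by omega)) hc
      (by simp [hcn]) (by simp [Sat])).1 hP⟩
  · rintro ⟨s, rfl, hs⟩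
    -- The sentencehood of `T s` is, by definition, the closedness of `s`.
    exact ⟨s.code, ⟨s, h, rfl⟩, rfl, (sat_atVal hF (p := (· ∈ I.2.1)) (displayed_v (by omega)) h
      (by simp) (by simp [Sat])).2 hs⟩

theorem sat_par3 (hF : F.Represents) {φ : Fml} (h : φ.IsSentence) :
    Sat I e (F.par3 φ.quote) ↔ ∃ s : Term, φ = .nT s ∧ ParCond I φ := by
  have hneg : ∀ (n : ℕ) (c : Term), c.code = n → (Sat I (Function.update e (F.ix 3) n)
      (F.atNeg (fun y => .eq (Term.numeral φ.code) y) (.app1 .dT (F.v 3))) ↔ φ = .nT c) := by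
    rintro _ c rfl
    rw [sat_atNeg hF (p := (φ.code = ·)) (φ := .T c) ((displayed_v (by omega)).app1 _)
      (by simp [Term.eval, Fn1.eval, Fml.code]) (by simp [Sat])]
    exact ⟨fun h => Fml.code_injective h, fun h => h ▸ rfl⟩
  simp only [par3, Sat, sat_sentF_quote hF h, true_and, Fml.quote, eval_v, Function.update_self,
    sat_clTmF hF (avoids_v _)]
  constructor
  · rintro ⟨n, ⟨c, hc, hcn⟩, hφ, hP⟩
    obtain rfl := (hneg n c hcn).1 hφ
    exact ⟨c, rfl, (sat_atVal hF (p := (· ∈ I.2.1)) (displayed_v (by omega)) hc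
      (by simp [hcn]) (by simp [Sat])).1 hP⟩
  · rintro ⟨s, rfl, hs⟩
    exact ⟨s.code, ⟨s, h, rfl⟩, (hneg _ s rfl).2 rfl,
      (sat_atVal hF (p := (· ∈ I.2.1)) (displayed_v (by omega)) h (by simp) (by simp [Sat])).2 hs⟩

theorem sat_par4 (hF : F.Represents) {φ : Fml} (h : φ.IsSentence) :
    Sat I e (F.par4 φ.quote) ↔ ∃ ψ χ : Fml, φ = .and ψ χ ∧ ParCond I φ := by
  simp only [par4, Sat, sat_sentF_quote hF h, true_and, Fml.quote, Term.eval_numeral, Term.eval,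
    Fn2.eval, eval_v]
  constructor
  · rintro ⟨m, n, hφ, hc⟩
    obtain ⟨ψ, χ, rfl, h1, h2⟩ := Fml.exists_eq_and hφ
    exact ⟨ψ, χ, rfl, (sat_andClause (by simp [h1]) (by simp [h2])).1 hc⟩
  · rintro ⟨ψ, χ, rfl, hc⟩
    exact ⟨ψ.code, χ.code, by simp [Fml.code], (sat_andClause (by simp) (by simp)).2 hc⟩

theorem sat_par5 (hF : F.Represents) {φ : Fml} (h : φ.IsSentence) :
    Sat I e (F.par5 φ.quote) ↔ ∃ ψ χ : Fml, φ = .or ψ χ ∧ ParCond I φ := by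
  simp only [par5, Sat, sat_sentF_quote hF h, true_and, Fml.quote, Term.eval_numeral, Term.eval,
    Fn2.eval, eval_v]
  constructor
  · rintro ⟨m, n, hφ, hc⟩
    obtain ⟨ψ, χ, rfl, h1, h2⟩ := Fml.exists_eq_or hφ
    exact ⟨ψ, χ, rfl, (sat_orClause (by simp [h1]) (by simp [h2])).1 hc⟩
  · rintro ⟨ψ, χ, rfl, hc⟩
    exact ⟨ψ.code, χ.code, by simp [Fml.code], (sat_orClause (by simp) (by simp)).2 hc⟩

theorem sat_par6 (hF : F.Represents) {φ : Fml} (h : φ.IsSentence) :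
    Sat I e (F.par6 φ.quote) ↔ ∃ (k : ℕ) (ψ : Fml), φ = .all k ψ ∧ ParCond I φ := by
  simp only [par6, Sat, sat_sentF_quote hF h, true_and, Fml.quote, Term.eval_numeral, Term.eval,
    Fn2.eval, eval_v]
  constructor
  · rintro ⟨m, n, hφ, hc⟩
    obtain ⟨k, ψ, rfl, h1, h2⟩ := Fml.exists_eq_all hφ
    exact ⟨k, ψ, rfl, (sat_allClause hF (by omega) (by omega) h2.symm h1.symm).1 hc⟩
  · rintro ⟨k, ψ, rfl, hc⟩
    exact ⟨(Term.var k).code, ψ.code, by simp [Fml.code],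
      (sat_allClause hF (by omega) (by omega) (by simp) (by simp)).2 hc⟩

theorem sat_par7 (hF : F.Represents) {φ : Fml} (h : φ.IsSentence) :
    Sat I e (F.par7 φ.quote) ↔ ∃ (k : ℕ) (ψ : Fml), φ = .ex k ψ ∧ ParCond I φ := by
  simp only [par7, Sat, sat_sentF_quote hF h, true_and, Fml.quote, Term.eval_numeral, Term.eval,
    Fn2.eval, eval_v]
  constructor
  · rintro ⟨m, n, hφ, hc⟩
    obtain ⟨k, ψ, rfl, h1, h2⟩ := Fml.exists_eq_ex hφ
    exact ⟨k, ψ, rfl, (sat_exClause hF (by omega) (by omega) h2.symm h1.symm).1 hc⟩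
  · rintro ⟨k, ψ, rfl, hc⟩
    exact ⟨(Term.var k).code, ψ.code, by simp [Fml.code],
      (sat_exClause hF (by omega) (by omega) (by simp) (by simp)).2 hc⟩

theorem holds_par (hF : F.Represents) {φ : Fml} (h : φ.IsSentence) :
    Holds I (F.par φ.quote) ↔
      ParCond I φ ∨ BaseParadoxical φ ∨ BaseParadoxical φ.neg := by
  have hPi : ∀ e, Sat I e (F.par1 φ.quote) ↔ BaseParadoxical φ ∨ BaseParadoxical φ.neg :=
    fun e => by
      rw [← sat_Pi (I := I) (e := e) hF (displayed_of_closed (Term.fv_numeral φ.code))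
        (Term.eval_numeral e φ.code)]
      exact and_iff_right (sat_sentF_quote hF h)
  simp only [Holds, par, Sat, hPi, sat_par2 hF h, sat_par3 hF h, sat_par4 hF h, sat_par5 hF h,
    sat_par6 hF h, sat_par7 hF h, forall_const]
  rw [or_comm]
  refine or_congr_left ?_
  -- Disjuncts (2)–(7) belong to different outermost forms, so at most one survives for each shape
  -- of `φ`; for identities and `P`-literals none does.
  cases φ <;> simp [ParCond]

end Syn

/-! ### Consistency of the least fixed point -/

/-- The measure ignores terms, so the numeral instances of a quantified formula are strictly smaller
than it. -/
def Fml.depth : Fml → ℕ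
  | and φ ψ => max φ.depth ψ.depth + 1
  | or φ ψ => max φ.depth ψ.depth + 1
  | all _ φ => φ.depth + 1
  | ex _ φ => φ.depth + 1
  | _ => 0

theorem Fml.depth_subst (φ : Fml) (x : ℕ) (r : Term) : (φ.subst x r).depth = φ.depth := by
  induction φ with
  | all k φ ih | ex k φ ih => by_cases hk : k = x <;> simp [subst, depth, hk, ih]
  | _ => simp_all [subst, depth]

namespace Syn

variable {F : Syn}

/-- The properties of an interpretation that are preserved along the iteration of the jump. -/
structure Good (F : Syn) (I : Interp) : Prop where
  consistent : Consistent I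
  le_jump : I ≤ F.jump I
  pos_subset : I.1.1 ⊆ I.2.2
  neg_subset : I.1.2 ⊆ I.2.2

variable {I : Interp}

theorem Good.holds_of_mem (h : F.Good I) {φ : Fml} (hφ : φ.code ∈ I.1.1) :
    φ.IsSentence ∧ Holds I φ := mem_codes.1 (h.le_jump.1.1 hφ)

theorem Good.holds_neg_of_mem (h : F.Good I) {φ : Fml} (hφ : φ.code ∈ I.1.2) :
    φ.IsSentence ∧ Holds I φ.neg := mem_codes.1 (h.le_jump.1.2 hφ)

theorem Good.par_of_mem (hF : F.Represents) (h : F.Good I) {φ : Fml} (hφ : φ.code ∈ I.2.1) :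
    φ.IsSentence ∧ (ParCond I φ ∨ BaseParadoxical φ ∨ BaseParadoxical φ.neg) := by
  obtain ⟨h1, h2⟩ := mem_codes.1 (h.le_jump.2.1 hφ)
  exact ⟨h1, (holds_par hF h1).1 h2⟩

/-- The liar argument: if `φ` holds, soundness of `PA[SK]` puts it into `T⁻`, and `I ≤ jump I` makes
`¬φ` hold, against consistency. If `¬φ` holds, then `φ` is in `T⁺` and holds as well. -/
theorem Good.not_sat_of_baseParadoxical (h : F.Good I) {φ : Fml} (hφ : BaseParadoxical φ)
    (e : ℕ → ℕ) : ¬ Sat I e φ ∧ ¬ Sat I e φ.neg := by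
  obtain ⟨hs, ⟨h1, -⟩, h2, -⟩ := hφ
  constructor
  · intro hsat
    have := PASK.sound h.consistent h1 e (by simpa using hsat)
    simp only [Finset.mem_singleton, exists_eq_left, Sat, Fml.quote, Term.eval_numeral] at this
    exact h.consistent.not_sat_neg hsat ((h.holds_neg_of_mem this).2 e)
  · intro hsat
    have := PASK.sound h.consistent h2 e (by simpa using hsat)
    simp only [Fml.neg, Finset.mem_singleton, exists_eq_left, Sat, Fml.quote,
      Term.eval_numeral] at this
    exact h.consistent.not_sat_neg ((h.holds_of_mem this).2 e) hsat

/-- Each clause for a compound demands an indeterminate constituent while the others are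
indeterminate or have the value that does not settle the compound; Strong Kleene evaluation then
leaves the compound without a value. -/
theorem Good.not_sat_of_par (hF : F.Represents) (h : F.Good I) (e : ℕ → ℕ) (φ : Fml)
    (hs : φ.IsSentence) (hφ : ParCond I φ ∨ BaseParadoxical φ ∨ BaseParadoxical φ.neg) :
    ¬ Sat I e φ ∧ ¬ Sat I e φ.neg := by
  rcases hφ with hφ | hφ | hφ
  rotate_left
  · exact h.not_sat_of_baseParadoxical hφ e
  · simpa [and_comm] using h.not_sat_of_baseParadoxical hφ e
  -- By `I ≤ jump I`, members of `P⁺` themselves satisfy 𝒫, which makes the recursion on depth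
  -- applicable to constituents.
  have hP : ∀ {ψ : Fml}, ψ.depth < φ.depth → ψ.code ∈ I.2.1 →
      ¬ Sat I e ψ ∧ ¬ Sat I e ψ.neg := fun hd hψ =>
    h.not_sat_of_par hF e _ (h.par_of_mem hF hψ).1 (h.par_of_mem hF hψ).2
  have hT : ∀ {ψ : Fml}, ψ.code ∈ I.1.1 → ¬ Sat I e ψ.neg := fun hψ =>
    h.consistent.not_sat_neg ((h.holds_of_mem hψ).2 e)
  have hN : ∀ {ψ : Fml}, ψ.code ∈ I.1.2 → ¬ Sat I e ψ := fun hψ hsat =>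
    h.consistent.not_sat_neg hsat ((h.holds_neg_of_mem hψ).2 e)
  have hdisj := Set.disjoint_left.1 h.consistent.2
  cases φ with
  | eq | ne | P | nP => exact hφ.elim
  | T t =>
    -- The sentence named by `t` may have any depth, so recursion is unavailable; the inclusions of
    -- `T⁺` and `T⁻` in `P⁻` take its place.
    have ht : t.eval e ∈ I.2.1 := Term.eval_closed hs 0 e ▸ hφ
    exact ⟨fun h' => hdisj ht (h.pos_subset h'), fun h' => hdisj ht (h.neg_subset h')⟩
  | nT t =>
    have ht : t.eval e ∈ I.2.1 := Term.eval_closed hs 0 e ▸ hφ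
    exact ⟨fun h' => hdisj ht (h.neg_subset h'), fun h' => hdisj ht (h.pos_subset h')⟩
  | and φ ψ =>
    have h1 := @hP φ (by simp [Fml.depth])
    have h2 := @hP ψ (by simp [Fml.depth])
    have h3 := @hT φ
    have h4 := @hT ψ
    simp only [ParCond, Fml.neg, Sat] at *
    tauto
  | or φ ψ =>
    have h1 := @hP φ (by simp [Fml.depth])
    have h2 := @hP ψ (by simp [Fml.depth])
    have h3 := @hN φ
    have h4 := @hN ψ
    simp only [ParCond, Fml.neg, Sat] at *
    tauto
  | all k φ =>
    have hd : ∀ n, (φ.subst k (Term.numeral n)).depth < (Fml.all k φ).depth := fun n => by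
      simp [Fml.depth, Fml.depth_subst]
    obtain ⟨⟨n, hn⟩, hall⟩ := hφ
    refine ⟨fun h' => (hP (hd n) hn).1 (sat_inst.2 (h' n)), fun ⟨m, hm⟩ => ?_⟩
    rw [← sat_inst, ← Fml.neg_subst] at hm
    exact (hall m).elim (fun h' => (hP (hd m) h').2 hm) fun h' => hT h' hm
  | ex k φ =>
    have hd : ∀ n, (φ.subst k (Term.numeral n)).depth < (Fml.ex k φ).depth := fun n => by
      simp [Fml.depth, Fml.depth_subst]
    obtain ⟨⟨n, hn⟩, hall⟩ := hφ
    refine ⟨fun ⟨m, hm⟩ => ?_, fun h' => (hP (hd n) hn).2 ?_⟩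
    · rw [← sat_inst] at hm
      exact (hall m).elim (fun h' => (hP (hd m) h').1 hm) fun h' => hN h' hm
    · rw [Fml.neg_subst, sat_inst]
      exact h' n
termination_by φ.depth

/-- The new `P⁻` consists of the determinate sentences. It thus contains the new `T⁺` and `T⁻`, and
it misses the new `P⁺` by `Good.not_sat_of_par`. -/
theorem Good.jump (hF : F.Represents) (h : F.Good I) : F.Good (F.jump I) where
  consistent := by
    constructor
    · refine Set.disjoint_left.2 ?_
      rintro _ ⟨φ, -, hφ, rfl⟩ hn
      exact h.consistent.not_sat_neg (hφ 0) ((mem_codes.1 hn).2 0)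
    · refine Set.disjoint_left.2 ?_
      rintro _ ⟨φ, hs, hφ, rfl⟩ hn
      have := h.not_sat_of_par hF 0 φ hs ((holds_par hF hs).1 hφ)
      exact ((mem_codes.1 hn).2 0).elim this.1 this.2
  le_jump := F.jump.monotone h.le_jump
  pos_subset := codes_mono fun _ hφ e => Or.inl (hφ e)
  neg_subset := codes_mono fun _ hφ e => Or.inr (hφ e)

/-! ### Unions of chains of good interpretations -/

theorem disjoint_biUnion_of_isChain {ι : Type*} [Preorder ι] {c : Set ι} (hc : IsChain (· ≤ ·) c)
    {f g : ι → Set ℕ} (hf : Monotone f) (hg : Monotone g) (h : ∀ i ∈ c, Disjoint (f i) (g i)) :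
    Disjoint (⋃ i ∈ c, f i) (⋃ i ∈ c, g i) := by
  simp only [Set.disjoint_iUnion_left, Set.disjoint_iUnion_right]
  intro i hi j hj
  rcases hc.total hi hj with hij | hij
  · exact (h j hj).mono_right (hg hij)
  · exact (h i hi).mono_left (hf hij)

/-- A number in both an extension and its anti-extension would already be so in the larger of two
members of the chain. The empty chain is included and gives the empty interpretation as a starting
point. -/
theorem good_sSup {c : Set Interp} (hc : IsChain (· ≤ ·) c) (h : ∀ J ∈ c, F.Good J) :
    F.Good (sSup c) := by
  have h11 : (sSup c).1.1 = ⋃ J ∈ c, J.1.1 := by simp [sSup_eq_iSup, Prod.fst_iSup]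
  have h12 : (sSup c).1.2 = ⋃ J ∈ c, J.1.2 := by simp [sSup_eq_iSup, Prod.fst_iSup, Prod.snd_iSup]
  have h21 : (sSup c).2.1 = ⋃ J ∈ c, J.2.1 := by simp [sSup_eq_iSup, Prod.fst_iSup, Prod.snd_iSup]
  have h22 : (sSup c).2.2 = ⋃ J ∈ c, J.2.2 := by simp [sSup_eq_iSup, Prod.snd_iSup]
  refine ⟨⟨?_, ?_⟩, sSup_le fun J hJ => (h J hJ).le_jump.trans (F.jump.monotone (le_sSup hJ)),
    ?_, ?_⟩
  · rw [h11, h12]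
    exact disjoint_biUnion_of_isChain hc (fun _ _ h => h.1.1) (fun _ _ h => h.1.2)
      fun J hJ => (h J hJ).consistent.1
  · rw [h21, h22]
    exact disjoint_biUnion_of_isChain hc (fun _ _ h => h.2.1) (fun _ _ h => h.2.2)
      fun J hJ => (h J hJ).consistent.2
  · rw [h11, h22]
    exact Set.biUnion_mono subset_rfl fun J hJ => (h J hJ).pos_subset
  · rw [h12, h22]
    exact Set.biUnion_mono subset_rfl fun J hJ => (h J hJ).neg_subset

theorem jump_leastFix : F.jump F.leastFix = F.leastFix := F.jump.map_lfp

/-- A maximal good interpretation below the least fixed point is a fixed point. -/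
theorem good_leastFix (hF : F.Represents) : F.Good F.leastFix := by
  obtain ⟨M, ⟨hM, hle⟩, hmax⟩ := zorn_le₀ {J | F.Good J ∧ J ≤ F.leastFix} fun c hcs hc =>
    ⟨sSup c, ⟨good_sSup hc fun J hJ => (hcs hJ).1, sSup_le fun J hJ => (hcs hJ).2⟩,
      fun J hJ => le_sSup hJ⟩
  have h1 : F.jump M ≤ M :=
    hmax ⟨hM.jump hF, (F.jump.monotone hle).trans_eq jump_leastFix⟩ hM.le_jump
  have h2 : F.leastFix = M := le_antisymm (OrderHom.lfp_le _ h1) hle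
  rwa [h2]

end Syn

namespace Syn

/-! ### The principles at a fixed point of the jump -/

variable {F : Syn} {I : Interp}

/-- One component of the fixed-point equation; the assignment `0` is an arbitrary choice, harmless
for a sentence. -/
theorem sat_T (hfix : F.jump I = I) {e : ℕ → ℕ} {t : Term} {φ : Fml} (h : φ.IsSentence)
    (ht : t.eval e = φ.code) : Sat I e (.T t) ↔ Sat I 0 φ := by
  have : φ.code ∈ (F.jump I).1.1 ↔ Sat I 0 φ :=
    mem_codes.trans ((and_iff_right h).trans (h.holds_iff 0))
  rwa [hfix, ← ht] at this

theorem sat_nT (hfix : F.jump I = I) {e : ℕ → ℕ} {t : Term} {φ : Fml} (h : φ.IsSentence)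
    (ht : t.eval e = φ.code) : Sat I e (.nT t) ↔ Sat I 0 φ.neg := by
  have : φ.code ∈ (F.jump I).1.2 ↔ Sat I 0 φ.neg :=
    mem_codes.trans ((and_iff_right h).trans ((Fml.isSentence_neg.2 h).holds_iff 0))
  rwa [hfix, ← ht] at this

theorem sat_P (hF : F.Represents) (hfix : F.jump I = I) {e : ℕ → ℕ} {t : Term} {φ : Fml}
    (h : φ.IsSentence) (ht : t.eval e = φ.code) :
    Sat I e (.P t) ↔ ParCond I φ ∨ BaseParadoxical φ ∨ BaseParadoxical φ.neg := by
  have : φ.code ∈ (F.jump I).2.1 ↔ ParCond I φ ∨ BaseParadoxical φ ∨ BaseParadoxical φ.neg :=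
    mem_codes.trans ((and_iff_right h).trans (holds_par hF h))
  rwa [hfix, ← ht] at this

theorem sat_nP (hfix : F.jump I = I) {e : ℕ → ℕ} {t : Term} {φ : Fml} (h : φ.IsSentence)
    (ht : t.eval e = φ.code) : Sat I e (.nP t) ↔ Sat I 0 φ ∨ Sat I 0 φ.neg := by
  have hs : (Fml.or φ φ.neg).IsSentence :=
    Finset.union_eq_empty.2 ⟨h, Fml.isSentence_neg.2 h⟩
  have : φ.code ∈ (F.jump I).2.2 ↔ Sat I 0 φ ∨ Sat I 0 φ.neg :=
    mem_codes.trans ((and_iff_right h).trans (hs.holds_iff 0))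
  rwa [hfix, ← ht] at this

theorem seqHolds_of_mem_bi {G : Finset Fml} {a b : Fml} {S : Sequent}
    (h : ∀ e, (∀ γ ∈ G, Sat I e γ) → (Sat I e a ↔ Sat I e b)) (hS : S ∈ bi G a b) :
    SeqHolds I S := by
  rcases hS with rfl | rfl <;> intro e hΓ <;>
    simp only [Finset.forall_mem_insert, Finset.mem_singleton, exists_eq_left] at hΓ ⊢
  · exact (h e hΓ.2).1 hΓ.1
  · exact (h e hΓ.2).2 hΓ.1

theorem exists_closed (hF : F.Represents) {e : ℕ → ℕ} {i : ℕ} {G : Finset Fml}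
    (hG : ∀ γ ∈ G, Sat I e γ) (h : F.clTmF (F.v i) ∈ G) :
    ∃ c : Term, c.fv = ∅ ∧ e (F.ix i) = c.code := by
  obtain ⟨c, hc, hce⟩ := (sat_clTmF hF (avoids_v _)).1 (hG _ h)
  exact ⟨c, hc, hce.symm⟩

theorem exists_sentence (hF : F.Represents) {e : ℕ → ℕ} {t : Term} {G : Finset Fml}
    (hG : ∀ γ ∈ G, Sat I e γ) (ht : F.Displayed t) (h : F.sentF t ∈ G) :
    ∃ φ : Fml, φ.IsSentence ∧ φ.code = t.eval e :=
  (sat_sentF hF ht.avoids).1 (hG _ h)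

/-- The side condition speaks only of the compound; unique readability of codes turns it into
information about the two arguments. -/
theorem exists_and (hF : F.Represents) {e : ℕ → ℕ} {G : Finset Fml} (hG : ∀ γ ∈ G, Sat I e γ)
    (h : F.sentF (.app2 .dAnd (F.v 0) (F.v 1)) ∈ G) :
    ∃ φ ψ : Fml, (Fml.and φ ψ).IsSentence ∧ e (F.ix 0) = φ.code ∧ e (F.ix 1) = ψ.code := by
  obtain ⟨χ, hs, hχ⟩ :=
    exists_sentence hF hG ((displayed_v (by omega)).app2 (displayed_v (by omega)) _) h
  obtain ⟨φ, ψ, rfl, h1, h2⟩ := Fml.exists_eq_and hχ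
  exact ⟨φ, ψ, hs, h1.symm, h2.symm⟩

theorem exists_or (hF : F.Represents) {e : ℕ → ℕ} {G : Finset Fml} (hG : ∀ γ ∈ G, Sat I e γ)
    (h : F.sentF (.app2 .dOr (F.v 0) (F.v 1)) ∈ G) :
    ∃ φ ψ : Fml, (Fml.or φ ψ).IsSentence ∧ e (F.ix 0) = φ.code ∧ e (F.ix 1) = ψ.code := by
  obtain ⟨χ, hs, hχ⟩ :=
    exists_sentence hF hG ((displayed_v (by omega)).app2 (displayed_v (by omega)) _) h
  obtain ⟨φ, ψ, rfl, h1, h2⟩ := Fml.exists_eq_or hχ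
  exact ⟨φ, ψ, hs, h1.symm, h2.symm⟩

theorem exists_all (hF : F.Represents) {e : ℕ → ℕ} {G : Finset Fml} (hG : ∀ γ ∈ G, Sat I e γ)
    (h : F.sentF (.app2 .dAll (F.v 0) (F.v 1)) ∈ G) :
    ∃ (k : ℕ) (φ : Fml), (Fml.all k φ).IsSentence ∧ e (F.ix 0) = (Term.var k).code ∧
      e (F.ix 1) = φ.code := by
  obtain ⟨χ, hs, hχ⟩ :=
    exists_sentence hF hG ((displayed_v (by omega)).app2 (displayed_v (by omega)) _) h
  obtain ⟨k, φ, rfl, h1, h2⟩ := Fml.exists_eq_all hχ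
  exact ⟨k, φ, hs, h1.symm, h2.symm⟩

theorem exists_ex (hF : F.Represents) {e : ℕ → ℕ} {G : Finset Fml} (hG : ∀ γ ∈ G, Sat I e γ)
    (h : F.sentF (.app2 .dEx (F.v 0) (F.v 1)) ∈ G) :
    ∃ (k : ℕ) (φ : Fml), (Fml.ex k φ).IsSentence ∧ e (F.ix 0) = (Term.var k).code ∧
      e (F.ix 1) = φ.code := by
  obtain ⟨χ, hs, hχ⟩ :=
    exists_sentence hF hG ((displayed_v (by omega)).app2 (displayed_v (by omega)) _) h
  obtain ⟨k, φ, rfl, h1, h2⟩ := Fml.exists_eq_ex hχ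
  exact ⟨k, φ, hs, h1.symm, h2.symm⟩

theorem seqHolds_T1 (hF : F.Represents) (hfix : F.jump I = I) : ∀ S ∈ F.T1, SeqHolds I S := by
  rintro S (hS | hS) <;> refine seqHolds_of_mem_bi (fun e hG => ?_) hS <;>
    obtain ⟨c, hc, hce⟩ := exists_closed hF (i := 0) hG (by simp) <;>
    obtain ⟨d, hd, hde⟩ := exists_closed hF (i := 1) hG (by simp)
  · rw [sat_atVal2 hF (r := (· = ·)) (displayed_v (by omega)) (displayed_v (by omega)) hc hd hce
      hde (by simp [Sat]), sat_T hfix (φ := .eq c d) (Finset.union_eq_empty.2 ⟨hc, hd⟩)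
      (by simp [Term.eval, Fn2.eval, Fml.code, hce, hde])]
    rfl
  · rw [sat_atVal2 hF (r := (· ≠ ·)) (displayed_v (by omega)) (displayed_v (by omega)) hc hd hce
      hde (by simp [Sat]), sat_T hfix (φ := .ne c d) (Finset.union_eq_empty.2 ⟨hc, hd⟩)
      (by simp [Term.eval, Fn2.eval, Fml.code, hce, hde])]
    rfl

theorem seqHolds_T2 (hF : F.Represents) (hfix : F.jump I = I) : ∀ S ∈ F.T2, SeqHolds I S := by
  rintro S (hS | hS) <;> refine seqHolds_of_mem_bi (fun e hG => ?_) hS <;>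
    obtain ⟨c, hc, hce⟩ := exists_closed hF (i := 0) hG (by simp)
  · rw [sat_atVal hF (p := (· ∈ I.2.1)) (displayed_v (by omega)) hc hce (by simp [Sat]),
      sat_T hfix (φ := .P c) hc (by simp [Term.eval, Fn1.eval, Fml.code, hce])]
    rfl
  · rw [sat_atVal hF (p := (· ∈ I.2.2)) (displayed_v (by omega)) hc hce (by simp [Sat]),
      sat_T hfix (φ := .nP c) hc (by simp [Term.eval, Fn1.eval, Fml.code, hce])]
    rfl

theorem seqHolds_T3 (hF : F.Represents) (hfix : F.jump I = I) : ∀ S ∈ F.T3, SeqHolds I S := by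
  rintro S (hS | hS) <;> refine seqHolds_of_mem_bi (fun e hG => ?_) hS
  · obtain ⟨c, hc, hce⟩ := exists_closed hF (i := 0) hG (by simp)
    rw [sat_atVal hF (p := (· ∈ I.1.1)) (displayed_v (by omega)) hc hce (by simp [Sat]),
      sat_T hfix (φ := .T c) hc (by simp [Term.eval, Fn1.eval, Fml.code, hce])]
    rfl
  · obtain ⟨φ, hs, hφ⟩ := exists_sentence hF (t := F.v 0) hG (displayed_v (by omega)) (by simp)
    -- At a fixed point both sides say that the negation of `φ` holds.
    rw [sat_atNeg hF (p := (· ∈ I.1.1)) (displayed_v (by omega)) hφ.symm (by simp [Sat]),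
      sat_nT hfix hs hφ.symm, ← sat_T hfix (e := 0) (t := φ.neg.quote) (Fml.isSentence_neg.2 hs)
      (Term.eval_numeral _ _), Sat, Fml.quote, Term.eval_numeral]

theorem seqHolds_T4 (hF : F.Represents) (hfix : F.jump I = I) : ∀ S ∈ F.T4, SeqHolds I S := by
  rintro S (hS | hS) <;> refine seqHolds_of_mem_bi (fun e hG => ?_) hS
  · obtain ⟨φ, ψ, hs, hφ, hψ⟩ := exists_and hF hG (by simp)
    rw [sat_T hfix hs (by simp [Term.eval, Fn2.eval, Fml.code, hφ, hψ])]
    exact and_congr (sat_T hfix hs.of_and.1 hφ) (sat_T hfix hs.of_and.2 hψ)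
  · obtain ⟨φ, ψ, hs, hφ, hψ⟩ := exists_or hF hG (by simp)
    rw [sat_T hfix hs (by simp [Term.eval, Fn2.eval, Fml.code, hφ, hψ])]
    exact or_congr (sat_T hfix hs.of_or.1 hφ) (sat_T hfix hs.of_or.2 hψ)

theorem code_inst_mem (hfix : F.jump I = I) {k : ℕ} {φ : Fml} (h : φ.fv.erase k = ∅) (n : ℕ) :
    (φ.subst k (Term.numeral n)).code ∈ I.1.1 ↔ Sat I (Function.update 0 k n) φ := by
  rw [← sat_inst, ← sat_T hfix (e := 0) (t := (φ.subst k (Term.numeral n)).quote)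
    (Fml.isSentence_inst h n) (Term.eval_numeral _ _), Sat, Fml.quote, Term.eval_numeral]

theorem seqHolds_T5 (hF : F.Represents) (hfix : F.jump I = I) : ∀ S ∈ F.T5, SeqHolds I S := by
  rintro S (hS | hS) <;> refine seqHolds_of_mem_bi (fun e hG => ?_) hS
  · obtain ⟨k, φ, hs, hk, hφ⟩ := exists_all hF hG (by simp)
    rw [sat_T hfix hs (by simp [Term.eval, Fn2.eval, Fml.code, hφ, hk])]
    exact forall_congr' fun n => (sat_atInst_v hF (by omega) (by omega) hφ hk
      (fun _ _ => Iff.rfl) n).trans (code_inst_mem hfix hs n)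
  · obtain ⟨k, φ, hs, hk, hφ⟩ := exists_ex hF hG (by simp)
    rw [sat_T hfix hs (by simp [Term.eval, Fn2.eval, Fml.code, hφ, hk])]
    exact exists_congr fun n => (sat_atInst_v hF (by omega) (by omega) hφ hk
      (fun _ _ => Iff.rfl) n).trans (code_inst_mem hfix hs n)

theorem seqHolds_P1 (hF : F.Represents) (hfix : F.jump I = I) : ∀ S ∈ F.P1, SeqHolds I S := by
  rintro _ rfl e hG
  obtain ⟨φ, hs, hφ⟩ := exists_sentence hF (t := F.v 0) hG (displayed_v (by omega)) (by simp)
  refine ⟨_, Finset.mem_singleton_self _, (sat_P hF hfix hs hφ.symm).2 (Or.inr ?_)⟩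
  exact (sat_Pi hF (displayed_v (by omega)) hφ.symm).1 (hG _ (by simp))

/-- `ParCond` does not distinguish a `T`- or `P`-literal from its negation, and Π is symmetric under
negation because `¬¬φ` is `φ`. -/
theorem seqHolds_P2 (hF : F.Represents) (hfix : F.jump I = I) : ∀ S ∈ F.P2, SeqHolds I S := by
  rintro S (hS | hS) <;> refine seqHolds_of_mem_bi (fun e hG => ?_) hS <;>
    obtain ⟨c, hc, hce⟩ := exists_closed hF (i := 0) hG (by simp)
  · rw [sat_P hF hfix (φ := .nT c) hc (by simp [Term.eval, Fn1.eval, Fml.code, hce]),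
      sat_P hF hfix (φ := .T c) hc (by simp [Term.eval, Fn1.eval, Fml.code, hce])]
    exact or_congr Iff.rfl or_comm
  · rw [sat_P hF hfix (φ := .nP c) hc (by simp [Term.eval, Fn1.eval, Fml.code, hce]),
      sat_P hF hfix (φ := .P c) hc (by simp [Term.eval, Fn1.eval, Fml.code, hce])]
    exact or_congr Iff.rfl or_comm

/-- A compositional principle for `P` holds once its first disjunct expresses `ParCond`. -/
theorem sat_P_iff_or_Pi (hF : F.Represents) (hfix : F.jump I = I) {e : ℕ → ℕ} {t : Term}
    {φ c : Fml} (h : φ.IsSentence) (hd : F.Displayed t) (ht : t.eval e = φ.code)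
    (hc : Sat I e c ↔ ParCond I φ) : Sat I e (.P t) ↔ Sat I e (.or c (F.Pi t)) := by
  rw [sat_P hF hfix h ht]
  exact or_congr hc.symm (sat_Pi hF hd ht).symm

theorem seqHolds_P3 (hF : F.Represents) (hfix : F.jump I = I) : ∀ S ∈ F.P3, SeqHolds I S := by
  refine fun S hS => seqHolds_of_mem_bi (fun e hG => ?_) hS
  obtain ⟨c, hc, hce⟩ := exists_closed hF (i := 0) hG (by simp)
  exact sat_P_iff_or_Pi hF hfix (φ := .T c) hc ((displayed_v (by omega)).app1 _)
    (by simp [Term.eval, Fn1.eval, Fml.code, hce])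
    (sat_atVal hF (p := (· ∈ I.2.1)) (displayed_v (by omega)) hc hce (by simp [Sat]))

theorem seqHolds_P4 (hF : F.Represents) (hfix : F.jump I = I) : ∀ S ∈ F.P4, SeqHolds I S := by
  refine fun S hS => seqHolds_of_mem_bi (fun e hG => ?_) hS
  obtain ⟨φ, ψ, hs, hφ, hψ⟩ := exists_and hF hG (by simp)
  exact sat_P_iff_or_Pi hF hfix hs ((displayed_v (by omega)).app2 (displayed_v (by omega)) _)
    (by simp [Term.eval, Fn2.eval, Fml.code, hφ, hψ]) (sat_andClause hφ hψ)

theorem seqHolds_P5 (hF : F.Represents) (hfix : F.jump I = I) : ∀ S ∈ F.P5, SeqHolds I S := by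
  refine fun S hS => seqHolds_of_mem_bi (fun e hG => ?_) hS
  obtain ⟨φ, ψ, hs, hφ, hψ⟩ := exists_or hF hG (by simp)
  exact sat_P_iff_or_Pi hF hfix hs ((displayed_v (by omega)).app2 (displayed_v (by omega)) _)
    (by simp [Term.eval, Fn2.eval, Fml.code, hφ, hψ]) (sat_orClause hφ hψ)

theorem seqHolds_P6 (hF : F.Represents) (hfix : F.jump I = I) : ∀ S ∈ F.P6, SeqHolds I S := by
  refine fun S hS => seqHolds_of_mem_bi (fun e hG => ?_) hS
  obtain ⟨k, φ, hs, hk, hφ⟩ := exists_all hF hG (by simp)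
  exact sat_P_iff_or_Pi hF hfix hs ((displayed_v (by omega)).app2 (displayed_v (by omega)) _)
    (by simp [Term.eval, Fn2.eval, Fml.code, hφ, hk])
    (sat_allClause hF (by omega) (by omega) hφ hk)

theorem seqHolds_P7 (hF : F.Represents) (hfix : F.jump I = I) : ∀ S ∈ F.P7, SeqHolds I S := by
  refine fun S hS => seqHolds_of_mem_bi (fun e hG => ?_) hS
  obtain ⟨k, φ, hs, hk, hφ⟩ := exists_ex hF hG (by simp)
  exact sat_P_iff_or_Pi hF hfix hs ((displayed_v (by omega)).app2 (displayed_v (by omega)) _)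
    (by simp [Term.eval, Fn2.eval, Fml.code, hφ, hk])
    (sat_exClause hF (by omega) (by omega) hφ hk)

/-- At a fixed point the truth of `φ ∨ ¬φ` means that it holds, which is the condition defining
`P⁻`. -/
theorem seqHolds_I1 (hF : F.Represents) (hfix : F.jump I = I) : ∀ S ∈ F.I1, SeqHolds I S := by
  rintro _ rfl e hG
  obtain ⟨φ, hs, hφ⟩ := exists_sentence hF (t := F.v 0) hG (displayed_v (by omega)) (by simp)
  refine ⟨_, Finset.mem_singleton_self _, (sat_nP hfix hs hφ.symm).2 ?_⟩
  have h := (sat_atNeg hF (A := fun y => .T (.app2 .dOr (F.v 0) y))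
    (p := fun n => Nat.pair 11 (Nat.pair φ.code n) ∈ I.1.1) (displayed_v (by omega)) hφ.symm
    (by simp [Sat, Term.eval, Fn2.eval, hφ])).1
    (hG _ (by simp))
  refine (sat_T hfix (e := 0) (t := (Fml.or φ φ.neg).quote) (φ := .or φ φ.neg)
    (Finset.union_eq_empty.2 ⟨hs, Fml.isSentence_neg.2 hs⟩) (Term.eval_numeral _ _)).1 ?_
  simpa [Sat, Fml.quote, Fml.code] using h

theorem seqHolds_principles (hF : F.Represents) (hfix : F.jump I = I) :
    ∀ S ∈ F.principles, SeqHolds I S := by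
  rintro S ((((((((((((hS | hS) | hS) | hS) | hS) | hS) | hS) | hS) | hS) | hS) | hS) | hS) | hS)
  exacts [seqHolds_T1 hF hfix S hS, seqHolds_T2 hF hfix S hS, seqHolds_T3 hF hfix S hS,
    seqHolds_T4 hF hfix S hS, seqHolds_T5 hF hfix S hS, seqHolds_P1 hF hfix S hS,
    seqHolds_P2 hF hfix S hS, seqHolds_P3 hF hfix S hS, seqHolds_P4 hF hfix S hS,
    seqHolds_P5 hF hfix S hS, seqHolds_P6 hF hfix S hS, seqHolds_P7 hF hfix S hS,
    seqHolds_I1 hF hfix S hS]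

theorem isModel_leastFix (hF : F.Represents) : IsModel F.leastFix F.TP := fun _ _ h =>
  h.sound (good_leastFix hF).consistent fun S hS =>
    hS.elim (fun hS => PAInit.seqHolds hS _) (seqHolds_principles hF jump_leastFix S)

end Syn

end TruthPar

theorem mainTheorem1 (F : TruthPar.Syn) (hF : F.Represents) :
    TruthPar.IsModel F.leastFix F.TP ∧ TruthPar.OmegaConsistent F.TP :=
  ⟨TruthPar.Syn.isModel_leastFix hF, (TruthPar.Syn.isModel_leastFix hF).omegaConsistent⟩
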